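/- **Setting.** Let $\mathcal H$ be a finite-dimensional complex Hilbert space of dimension $d$ and let $(\mathcal P_t)_{t\ge 0}$ be a continuous quantum Markov semigroup on $\mathcal B(\mathcal H)$ (a continuous semigroup of unital completely positive maps, $\mathcal P_0=\mathrm{id}$) with generator $\mathcal L=\lim_{t\downarrow 0}\frac1t(\mathcal P_t-\mathrm{id})$. Assume that it has a faithful invariant state: a density matrix $\sigma>0$ with $\operatorname{Tr}[\sigma\mathcal P_t(X)]=\operatorname{Tr}[\sigma X]$ for all $t\ge0$, $X\in\mathcal B(\mathcal H)$. Let $$\mathcal N=\{X:\ \mathcal P_t(X^*Y)=\mathcal P_t(X)^*\mathcal P_t(Y),\ \mathcal P_t(YX^*)=\mathcal P_t(Y)\mathcal P_t(X)^*\ \ \forall t\ge 0,\ \forall Y\in\mathcal B(\mathcal H)\}$$ be the decoherence-free algebra, let $E_{\mathcal N}$ be the conditional expectation onto $\mathcal N$ compatible with $\sigma$ (the completely positive projection with image $\mathcal N$ and $\operatorname{Tr}[\sigma E_{\mathcal N}(X)]=\operatorname{Tr}[\sigma X]$ for all $X$), let $E_{\mathcal N*}$ be its predual, $\operatorname{Tr}[E_{\mathcal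 N}(X)Y]=\operatorname{Tr}[XE_{\mathcal N*}(Y)]$, and let $\sigma_{\operatorname{Tr}}=E_{\mathcal N*}(I/d)$. Put $\langle X,Y\rangle=\operatorname{Tr}[\sigma_{\operatorname{Tr}}^{1/2}X^*\sigma_{\operatorname{Tr}}^{1/2}Y]$ and $\|X\|_2^2=\langle X,X\rangle$, and let $\hat{\mathcal L}$ be the adjoint of $\mathcal L$ for $\langle\cdot,\cdot\rangle$. Let $\operatorname{Var}_{\mathcal N}(X)=\|X-E_{\mathcal N}(X)\|_2^2$ and $\mathcal E_{\mathcal L}(X)=-\langle X,\mathcal L(X)\rangle$. For $\lambda>0$, the decoherence-free Poincaré inequality $\mathrm{PI}_{\mathcal N}(\lambda)$ is the statement that $\lambda\operatorname{Var}_{\mathcal N}(X)\le\mathcal E_{\mathcal L}(X)$ for all selfadjoint $X$; $\lambda(\mathcal L)$ denotes the largest $\lambda>0$ for which it holds. The spectral gap of an operator with real spectrum is the absolute value of its greatest nonzero eigenvalue. The semigroup is called reversible if every $\mathcal P_t$ is selfadjoint for $\langle\cdot,\cdot\rangle$. **Theorem.** 1. If $\mathrm{PI}_{\mathcal N}(\lambda)$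 holds, then for every selfadjoint $X$ and every $t\ge0$, $$\operatorname{Var}_{\mathcal N}(\mathcal P_t(X))\le e^{-2\lambda t}\operatorname{Var}_{\mathcal N}(X).$$ 2. Let $\mathcal N\ne\mathcal B(\mathcal H)$. If $\mathrm{PI}_{\mathcal N}(\lambda)$ holds for some $\lambda>0$, then the optimal constant $\lambda(\mathcal L)$ exists and equals the spectral gap of $\frac12(\mathcal L+\hat{\mathcal L})$. 3. Let $\mathcal N\ne\mathcal B(\mathcal H)$. If the semigroup is reversible, then (without assuming a Poincaré inequality) $\lambda(\mathcal L)$ exists and equals the spectral gap of $\frac12(\mathcal L+\hat{\mathcal L})$, which is also the spectral gap of $\mathcal L$. -/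

import Mathlib

open Set

/-- `B(H)`, with the Mathlib structures of `H →L[ℂ] H`: `star` is the adjoint and `≤` is the
Loewner order. -/
abbrev Op (H : Type*) [NormedAddCommGroup H] [InnerProductSpace ℂ H] : Type _ := H →L[ℂ] H

/-- Linear maps `B(H) → B(H)` (all are continuous when `H` is finite dimensional), with the
operator norm. -/
abbrev SuperOp (H : Type*) [NormedAddCommGroup H] [InnerProductSpace ℂ H] : Type _ :=
  Op H →L[ℂ] Op H

namespace QMS

noncomputable section

variable {H : Type*} [NormedAddCommGroup H] [InnerProductSpace ℂ H]

/-- The trace on `B(H)`. -/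
def tr (X : Op H) : ℂ := LinearMap.trace ℂ H X.toLinearMap

/-- A faithful density matrix: strictly positive with trace one. -/
structure IsFaithfulState [CompleteSpace H] (σ : Op H) : Prop where
  pos : IsStrictlyPositive σ
  tr_eq_one : tr σ = 1

/-- Complete positivity: the entrywise extension to `k × k` matrices over `B(H)` is positive for
every `k` (the property in Mathlib's `CompletelyPositiveMap`). -/
def IsCP [CompleteSpace H] (Φ : SuperOp H) : Prop :=
  ∀ (k : ℕ) (M : CStarMatrix (Fin k) (Fin k) (Op H)), 0 ≤ M → 0 ≤ M.map Φ

/-- Continuous quantum Markov semigroup `(P t)_{t ≥ 0}` on `B(H)` (Heisenberg picture); the values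
of `P` at negative times play no role. -/
structure IsQMS [CompleteSpace H] (P : ℝ → SuperOp H) : Prop where
  map_zero : P 0 = ContinuousLinearMap.id ℂ (Op H)
  map_add : ∀ s t : ℝ, 0 ≤ s → 0 ≤ t → P (s + t) = (P s).comp (P t)
  cp : ∀ t : ℝ, 0 ≤ t → IsCP (P t)
  unital : ∀ t : ℝ, 0 ≤ t → P t 1 = 1
  cont : ContinuousOn P (Ici 0)

/-- The density matrix `σ` is invariant: `Tr[σ P_t(X)] = Tr[σ X]`. -/
def IsInvariant (P : ℝ → SuperOp H) (σ : Op H) : Prop :=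
  ∀ t : ℝ, 0 ≤ t → ∀ X : Op H, tr (σ * P t X) = tr (σ * X)

/-- The generator `L = lim_{t ↓ 0} (P_t - P_0) / t`. -/
def generator (P : ℝ → SuperOp H) : SuperOp H := derivWithin P (Ici 0) 0

/-- The decoherence-free algebra `N(P)`. -/
def dfAlgebra [CompleteSpace H] (P : ℝ → SuperOp H) : Set (Op H) :=
  {X | ∀ t : ℝ, 0 ≤ t → ∀ Y : Op H,
    P t (star X * Y) = star (P t X) * P t Y ∧ P t (Y * star X) = P t Y * star (P t X)}

/-- `E` is the conditional expectation onto `N(P)` compatible with `σ`: a completely positive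
projection with image `N(P)` such that `σ ∘ E = σ`. -/
structure IsDFCondExp [CompleteSpace H] (P : ℝ → SuperOp H) (σ : Op H) (E : SuperOp H) :
    Prop where
  cp : IsCP E
  idem : ∀ X : Op H, E (E X) = E X
  range_eq : Set.range E = dfAlgebra P
  compatible : ∀ X : Op H, tr (σ * E X) = tr (σ * X)

open Classical in
/-- The conditional expectation `E_N` onto `N(P)` compatible with `σ`. When `P` is a quantum Markov
semigroup with faithful invariant state `σ`, exactly one map satisfies `IsDFCondExp P σ`, and this
is that map (`0` is a dummy value for other `P`, `σ`). -/
def condExp [CompleteSpace H] (P : ℝ → SuperOp H) (σ : Op H) : SuperOp H :=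
  if h : ∃ E : SuperOp H, IsDFCondExp P σ E then h.choose else 0

lemma tr_add (X Y : Op H) : tr (X + Y) = tr X + tr Y := by simp [tr]

lemma tr_smul (c : ℂ) (X : Op H) : tr (c • X) = c * tr X := by simp [tr]

lemma tr_sum {ι : Type*} (s : Finset ι) (f : ι → Op H) :
    tr (∑ i ∈ s, f i) = ∑ i ∈ s, tr (f i) := by
  classical
  induction s using Finset.induction_on with
  | empty => simp [tr]
  | insert a s ha ih => rw [Finset.sum_insert ha, Finset.sum_insert ha, tr_add, ih]

lemma tr_mul_comm (X Y : Op H) : tr (X * Y) = tr (Y * X) :=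
  LinearMap.trace_mul_comm ℂ X.toLinearMap Y.toLinearMap

section predual

variable [FiniteDimensional ℂ H]

/-- The matrix units `|e_i⟩⟨e_j|` of a fixed orthonormal basis of `H`. -/
def matUnit (i j : Fin (Module.finrank ℂ H)) : Op H :=
  InnerProductSpace.rankOne ℂ (stdOrthonormalBasis ℂ H i) (stdOrthonormalBasis ℂ H j)

lemma tr_mul_matUnit (X : Op H) (i j : Fin (Module.finrank ℂ H)) :
    tr (X * matUnit j i) =
      inner ℂ (stdOrthonormalBasis ℂ H i) (X (stdOrthonormalBasis ℂ H j)) := by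
  have h : X * matUnit j i = InnerProductSpace.rankOne ℂ (X (stdOrthonormalBasis ℂ H j))
      (stdOrthonormalBasis ℂ H i) := by
    ext v
    simp [matUnit, InnerProductSpace.rankOne_apply]
  rw [h, tr, InnerProductSpace.trace_rankOne]

lemma eq_sum_matUnit (X : Op H) :
    X = ∑ i, ∑ j, tr (X * matUnit j i) • matUnit i j := by
  refine ContinuousLinearMap.coe_injective ((stdOrthonormalBasis ℂ H).toBasis.ext fun k => ?_)
  simp only [tr_mul_matUnit]
  simp only [matUnit, OrthonormalBasis.coe_toBasis, ContinuousLinearMap.coe_coe, sum_apply,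
    smul_apply, InnerProductSpace.rankOne_apply, OrthonormalBasis.inner_eq_ite]
  simp only [ite_smul, one_smul, zero_smul, smul_ite, smul_zero, Finset.sum_ite_eq',
    Finset.mem_univ, if_true]
  exact ((stdOrthonormalBasis ℂ H).sum_repr' _).symm

/-- The predual `Φ_*` of `Φ` for the trace pairing, `Tr[Φ(X) Y] = Tr[X Φ_*(Y)]`; see
`tr_map_mul` and `predual_unique`. -/
def predual (Φ : SuperOp H) : SuperOp H :=
  LinearMap.toContinuousLinearMap
    { toFun := fun Y => ∑ i, ∑ j, tr (Φ (matUnit i j) * Y) • matUnit j i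
      map_add' := fun Y Z => by
        simp only [mul_add, tr_add, add_smul, Finset.sum_add_distrib]
      map_smul' := fun c Y => by
        simp only [mul_smul_comm, tr_smul, mul_smul, Finset.smul_sum, RingHom.id_apply] }

lemma predual_apply (Φ : SuperOp H) (Y : Op H) :
    predual Φ Y = ∑ i, ∑ j, tr (Φ (matUnit i j) * Y) • matUnit j i := rfl

lemma tr_map_mul (Φ : SuperOp H) (X Y : Op H) : tr (Φ X * Y) = tr (X * predual Φ Y) := by
  conv_lhs => rw [eq_sum_matUnit X]
  simp only [predual_apply, map_sum, map_smul, Finset.sum_mul, Finset.mul_sum, smul_mul_assoc,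
    mul_smul_comm, tr_sum, tr_smul]
  exact Finset.sum_congr rfl fun i _ => Finset.sum_congr rfl fun j _ => mul_comm _ _

lemma predual_unique (Φ Ψ : SuperOp H) (h : ∀ X Y : Op H, tr (Φ X * Y) = tr (X * Ψ Y)) :
    Ψ = predual Φ := by
  ext1 Y
  rw [eq_sum_matUnit (Ψ Y), eq_sum_matUnit (predual Φ Y)]
  refine Finset.sum_congr rfl fun i _ => Finset.sum_congr rfl fun j _ => ?_
  rw [tr_mul_comm, ← h, tr_mul_comm (predual Φ Y), ← tr_map_mul]

end predual

section kms

variable [CompleteSpace H]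

/-- The scalar product `⟨X, Y⟩_σ = Tr[σ^{1/2} X^* σ^{1/2} Y]`. -/
def kms (σ X Y : Op H) : ℂ := tr (CFC.sqrt σ * star X * CFC.sqrt σ * Y)

/-- The squared norm `‖X‖²_{2,σ} = ⟨X, X⟩_σ` (a nonnegative real number). -/
def normSq (σ X : Op H) : ℝ := (kms σ X X).re

/-- The Dirichlet form `E_L(X) = -⟨X, L(X)⟩_σ`; for selfadjoint `X` and the generator `L` of a
quantum Markov semigroup the scalar product is real, so that taking the real part is harmless. -/
def dirichlet (σ : Op H) (L : SuperOp H) (X : Op H) : ℝ := -(kms σ X (L X)).re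

variable [FiniteDimensional ℂ H]

/-- The adjoint `Φ̂` of `Φ` for `⟨·,·⟩_σ`, where `σ` is positive and invertible; see
`kms_kmsAdjoint`. When `Φ` commutes with `star`, this is
`Φ̂(X) = σ^{-1/2} Φ_*(σ^{1/2} X σ^{1/2}) σ^{-1/2}`. -/
def kmsAdjoint (σ : Op H) (Φ : SuperOp H) : SuperOp H :=
  LinearMap.toContinuousLinearMap
    { toFun := fun X => Ring.inverse (CFC.sqrt σ) *
        star (predual Φ (star (CFC.sqrt σ * X * CFC.sqrt σ))) * Ring.inverse (CFC.sqrt σ)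
      map_add' := fun X Y => by simp [mul_add, add_mul]
      map_smul' := fun c X => by simp }

lemma kmsAdjoint_apply (σ : Op H) (Φ : SuperOp H) (X : Op H) :
    kmsAdjoint σ Φ X = Ring.inverse (CFC.sqrt σ) *
      star (predual Φ (star (CFC.sqrt σ * X * CFC.sqrt σ))) * Ring.inverse (CFC.sqrt σ) := rfl

lemma kms_kmsAdjoint (σ : Op H) (hσ : IsStrictlyPositive σ) (Φ : SuperOp H) (X Y : Op H) :
    kms σ (kmsAdjoint σ Φ X) Y = kms σ X (Φ Y) := by
  have hu : IsUnit (CFC.sqrt σ) := (CFC.isUnit_sqrt_iff σ hσ.nonneg).2 hσ.isUnit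
  have hs : star (CFC.sqrt σ) = CFC.sqrt σ := (CFC.sqrt_nonneg σ).isSelfAdjoint.star_eq
  have hi : star (Ring.inverse (CFC.sqrt σ)) = Ring.inverse (CFC.sqrt σ) := by
    rw [← Ring.inverse_star, hs]
  have key : CFC.sqrt σ * star (kmsAdjoint σ Φ X) * CFC.sqrt σ =
      predual Φ (CFC.sqrt σ * star X * CFC.sqrt σ) := by
    simp only [kmsAdjoint_apply, star_mul, star_star, hs, hi]
    rw [← mul_assoc, Ring.mul_inverse_cancel _ hu, one_mul, mul_assoc,
      Ring.inverse_mul_cancel _ hu, mul_one, mul_assoc]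
  rw [kms, key, kms, tr_mul_comm, ← tr_map_mul, tr_mul_comm]

/-- The reference state `σ_Tr = E_{N*}(I / d)`, where `d` is the dimension of `H`. -/
def sigmaTr (P : ℝ → SuperOp H) (σ : Op H) : Op H :=
  predual (condExp P σ) ((Module.finrank ℂ H : ℂ)⁻¹ • (1 : Op H))

/-- The decoherence-free variance `Var_N(X) = ‖X - E_N(X)‖²_{2,σ_Tr}`. -/
def dfVar (P : ℝ → SuperOp H) (σ X : Op H) : ℝ := normSq (sigmaTr P σ) (X - condExp P σ X)

/-- The decoherence-free Poincaré inequality `PI_N(lam)`. -/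
def PoincareIneq (P : ℝ → SuperOp H) (σ : Op H) (lam : ℝ) : Prop :=
  0 < lam ∧ ∀ X : Op H, IsSelfAdjoint X →
    lam * dfVar P σ X ≤ dirichlet (sigmaTr P σ) (generator P) X

/-- `γ` is the optimal constant `λ(L)` in the decoherence-free Poincaré inequality. -/
def IsPoincareConst (P : ℝ → SuperOp H) (σ : Op H) (γ : ℝ) : Prop :=
  IsGreatest {lam : ℝ | PoincareIneq P σ lam} γ

/-- The symmetrized generator `(L + L̂) / 2`, with `L̂` the adjoint of `L` for `⟨·,·⟩_{σ_Tr}`. -/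
def symGenerator (P : ℝ → SuperOp H) (σ : Op H) : SuperOp H :=
  (2⁻¹ : ℂ) • (generator P + kmsAdjoint (sigmaTr P σ) (generator P))

/-- `P` is reversible: every `P t` is selfadjoint for `⟨·,·⟩_{σ_Tr}`. -/
def IsReversible (P : ℝ → SuperOp H) (σ : Op H) : Prop :=
  ∀ t : ℝ, 0 ≤ t → ∀ X Y : Op H,
    kms (sigmaTr P σ) (P t X) Y = kms (sigmaTr P σ) X (P t Y)

end kms

/-- `γ` is the spectral gap of `T` (an operator with real spectrum): the absolute value of the
greatest nonzero eigenvalue of `T`. -/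
def IsSpectralGap (T : SuperOp H) (γ : ℝ) : Prop :=
  ∃ ν : ℝ, IsGreatest {μ : ℝ | μ ≠ 0 ∧ Module.End.HasEigenvalue T.toLinearMap (μ : ℂ)} ν ∧
    γ = |ν|

end

end QMS

/-!
The proof rests on the structure of the decoherence-free algebra `N = N(P)`.

By the Kadison-Schwarz inequality and Choi's theorem on multiplicative domains
(`IsCP.schwarz`, `IsCP.map_star_mul_of_eq`), `N` consists of the `X` for which all `P t` attain
equality in `P_t(X)^* P_t(X) ≤ P_t(X^* X)` for `X` and `X^*`. As `σ` is faithful and invariant, this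
means that the norm `Tr[σ X^* X]` stays constant along the orbits of `X` and `X^*`
(`IsQMS.mem_dfAlgebra_of_gnsSq_le`). The limit points of `P t` at infinity form a compact semigroup;
an idempotent in it is a conditional expectation onto `N` (`IsQMS.exists_isDFCondExp`). Any such
expectation is an `N`-bimodule map commuting with `P t` (`IsQMS.condExp_map`), the state `σ_Tr` is
faithful and commutes with `N` (`IsQMS.commute_sigmaTr`), and hence `E_N` is the orthogonal projection
onto `N` for `⟨·,·⟩_{σ_Tr}` (`IsQMS.kms_sub_condExp`).

The exponential decay of the variance is Grönwall's argument for `‖P_t(X - E_N(X))‖²`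
(`IsQMS.dfVar_map_le`).

On `N` the generator `L` is a derivation, and a derivation has trace zero on selfadjoint elements
(`IsQMS.tr_generator_of_isSelfAdjoint`); therefore the Dirichlet form vanishes on `N`. If
`K = (L + L̂) / 2` is negative semidefinite with kernel inside `N`, it follows that `ker K = N`, and
diagonalizing the symmetric operator `K` identifies the optimal constant with the spectral gap
(`IsQMS.exists_isPoincareConst`). A Poincaré inequality gives these two properties of `K` directly. In
the reversible case `K = L`; its eigenvalues are nonpositive because the semigroup is contractive, and
its kernel consists of fixed points of the semigroup, which lie in `N`.
-/

set_option linter.unusedSectionVars false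

namespace QMS

open scoped ComplexOrder

variable {H : Type*} [NormedAddCommGroup H] [InnerProductSpace ℂ H] [FiniteDimensional ℂ H]

/-! ### The trace and the scalar product `⟨·,·⟩_σ` -/

lemma tr_zero : tr (0 : Op H) = 0 := by simp [tr]

lemma tr_sub (X Y : Op H) : tr (X - Y) = tr X - tr Y := by simp [tr]

variable [CompleteSpace H]

lemma tr_star_mul_self (B : Op H) :
    tr (star B * B) = ((∑ i, ‖B (stdOrthonormalBasis ℂ H i)‖ ^ 2 : ℝ) : ℂ) := by
  rw [tr, LinearMap.trace_eq_sum_inner _ (stdOrthonormalBasis ℂ H)]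
  push_cast
  refine Finset.sum_congr rfl fun i _ => ?_
  simp [ContinuousLinearMap.star_eq_adjoint, ContinuousLinearMap.adjoint_inner_right]

lemma tr_star_mul_self_nonneg (B : Op H) : 0 ≤ tr (star B * B) := by
  rw [tr_star_mul_self]
  exact_mod_cast Finset.sum_nonneg fun i _ => by positivity

lemma eq_zero_of_tr_star_mul_self {B : Op H} (h : tr (star B * B) = 0) : B = 0 := by
  rw [tr_star_mul_self] at h
  have h' : ∑ i, ‖B (stdOrthonormalBasis ℂ H i)‖ ^ 2 = 0 := by exact_mod_cast h
  rw [Finset.sum_eq_zero_iff_of_nonneg fun i _ => by positivity] at h'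
  refine ContinuousLinearMap.coe_injective ((stdOrthonormalBasis ℂ H).toBasis.ext fun k => ?_)
  simpa using h' k (Finset.mem_univ k)

lemma tr_star (X : Op H) : tr (star X) = star (tr X) := by
  rw [tr, tr, LinearMap.trace_eq_sum_inner _ (stdOrthonormalBasis ℂ H),
    LinearMap.trace_eq_sum_inner _ (stdOrthonormalBasis ℂ H), star_sum]
  refine Finset.sum_congr rfl fun i _ => ?_
  simp [ContinuousLinearMap.star_eq_adjoint, ContinuousLinearMap.adjoint_inner_right]

lemma star_sqrt (σ : Op H) : star (CFC.sqrt σ) = CFC.sqrt σ :=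
  (CFC.sqrt_nonneg σ).isSelfAdjoint.star_eq

lemma sqrt_mul_sqrt {σ : Op H} (hσ : 0 ≤ σ) : CFC.sqrt σ * CFC.sqrt σ = σ :=
  CFC.sqrt_mul_sqrt_self σ hσ

lemma tr_mul_star_mul_self {σ : Op H} (hσ : 0 ≤ σ) (C : Op H) :
    tr (σ * (star C * C)) = tr (star (C * CFC.sqrt σ) * (C * CFC.sqrt σ)) := by
  conv_lhs => rw [← sqrt_mul_sqrt hσ]
  rw [star_mul, star_sqrt, mul_assoc, tr_mul_comm]
  simp only [mul_assoc]

lemma tr_mul_nonneg {σ A : Op H} (hσ : 0 ≤ σ) (hA : 0 ≤ A) : 0 ≤ tr (σ * A) := by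
  obtain ⟨C, rfl⟩ := CStarAlgebra.nonneg_iff_eq_star_mul_self.1 hA
  rw [tr_mul_star_mul_self hσ]
  exact tr_star_mul_self_nonneg _

lemma tr_nonneg {A : Op H} (hA : 0 ≤ A) : 0 ≤ tr A := by
  simpa using tr_mul_nonneg (zero_le_one (α := Op H)) hA

/-- The state with a strictly positive density is faithful. -/
lemma eq_zero_of_tr_mul_eq_zero {σ A : Op H} (hσ : IsStrictlyPositive σ) (hA : 0 ≤ A)
    (h : tr (σ * A) = 0) : A = 0 := by
  obtain ⟨C, rfl⟩ := CStarAlgebra.nonneg_iff_eq_star_mul_self.1 hA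
  rw [tr_mul_star_mul_self hσ.nonneg] at h
  have hu : IsUnit (CFC.sqrt σ) := (CFC.isUnit_sqrt_iff σ hσ.nonneg).2 hσ.isUnit
  have hC : C = 0 := hu.mul_left_eq_zero.1 (eq_zero_of_tr_star_mul_self h)
  simp [hC]

lemma eq_zero_of_tr_eq_zero {A : Op H} (hA : 0 ≤ A) (h : tr A = 0) : A = 0 :=
  eq_zero_of_tr_mul_eq_zero isStrictlyPositive_one hA (by simpa using h)

lemma isStrictlyPositive_sqrt {σ : Op H} (hσ : IsStrictlyPositive σ) :
    IsStrictlyPositive (CFC.sqrt σ) :=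
  (IsStrictlyPositive.iff_of_unital).2 ⟨CFC.sqrt_nonneg σ,
    (CFC.isUnit_sqrt_iff σ hσ.nonneg).2 hσ.isUnit⟩

lemma kms_conj_symm (σ X Y : Op H) : star (kms σ Y X) = kms σ X Y := by
  rw [kms, kms, ← tr_star]
  simp only [star_mul, star_sqrt, star_star]
  rw [← mul_assoc, ← mul_assoc, tr_mul_comm]
  simp only [mul_assoc]

lemma kms_star_star (σ X Y : Op H) : kms σ (star X) (star Y) = star (kms σ X Y) := by
  rw [kms, kms, ← tr_star, star_star]
  simp only [star_mul, star_sqrt, star_star]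
  rw [tr_mul_comm]
  simp only [mul_assoc]

lemma kms_self_nonneg (σ X : Op H) : 0 ≤ kms σ X X := by
  rw [kms, mul_assoc, mul_assoc]
  refine tr_mul_nonneg (CFC.sqrt_nonneg σ) ?_
  rw [← mul_assoc]
  exact star_left_conjugate_nonneg (CFC.sqrt_nonneg σ) X

lemma eq_zero_of_kms_self {σ X : Op H} (hσ : IsStrictlyPositive σ) (h : kms σ X X = 0) :
    X = 0 := by
  have hs := isStrictlyPositive_sqrt hσ
  rw [kms, mul_assoc, mul_assoc] at h
  have h1 := eq_zero_of_tr_mul_eq_zero hs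
    (by rw [← mul_assoc]; exact star_left_conjugate_nonneg (CFC.sqrt_nonneg σ) X) h
  have h2 : tr (CFC.sqrt σ * (X * star X)) = 0 := by
    rw [← mul_assoc, tr_mul_comm, h1, tr_zero]
  have h3 := eq_zero_of_tr_mul_eq_zero hs (mul_star_self_nonneg X) h2
  simpa using h3

lemma kms_add_left (σ X Y Z : Op H) : kms σ (X + Y) Z = kms σ X Z + kms σ Y Z := by
  simp [kms, mul_add, add_mul, tr_add]

lemma kms_add_right (σ X Y Z : Op H) : kms σ X (Y + Z) = kms σ X Y + kms σ X Z := by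
  simp [kms, mul_add, tr_add]

lemma kms_smul_left (σ X Y : Op H) (c : ℂ) : kms σ (c • X) Y = star c * kms σ X Y := by
  simp [kms, tr_smul]

lemma kms_smul_right (σ X Y : Op H) (c : ℂ) : kms σ X (c • Y) = c * kms σ X Y := by
  simp [kms, tr_smul]

lemma kms_sub_left (σ X Y Z : Op H) : kms σ (X - Y) Z = kms σ X Z - kms σ Y Z := by
  simp [kms, mul_sub, sub_mul, tr_sub]

lemma kms_sub_right (σ X Y Z : Op H) : kms σ X (Y - Z) = kms σ X Y - kms σ X Z := by
  simp [kms, mul_sub, tr_sub]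

/-- `⟨·,·⟩_σ` as an inner product on `B(H)`, for `σ` positive and invertible. -/
@[reducible]
noncomputable def kmsCore (σ : Op H) (hσ : IsStrictlyPositive σ) :
    InnerProductSpace.Core ℂ (Op H) where
  inner := kms σ
  conj_inner_symm X Y := kms_conj_symm σ X Y
  re_inner_nonneg X := (Complex.nonneg_iff.1 (kms_self_nonneg σ X)).1
  add_left := kms_add_left σ
  smul_left X Y c := kms_smul_left σ X Y c
  definite _ := eq_zero_of_kms_self hσ

lemma normSq_nonneg (σ X : Op H) : 0 ≤ normSq σ X :=
  (Complex.nonneg_iff.1 (kms_self_nonneg σ X)).1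

lemma kms_self_eq (σ X : Op H) : kms σ X X = (normSq σ X : ℂ) :=
  (Complex.ext rfl (by simpa using (Complex.nonneg_iff.1 (kms_self_nonneg σ X)).2.symm))

lemma eq_zero_of_normSq {σ X : Op H} (hσ : IsStrictlyPositive σ) (h : normSq σ X = 0) :
    X = 0 :=
  eq_zero_of_kms_self hσ (by rw [kms_self_eq, h, Complex.ofReal_zero])

lemma kms_ext {σ X Y : Op H} (hσ : IsStrictlyPositive σ) (h : ∀ Z, kms σ X Z = kms σ Y Z) :
    X = Y :=
  sub_eq_zero.1 (eq_zero_of_kms_self hσ (by rw [kms_sub_left, h, sub_self]))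

/-! ### Completely positive unital maps: Schwarz inequality and multiplicative domain -/

lemma _root_.CStarMatrix.apply_self_nonneg {k : ℕ} {M : CStarMatrix (Fin k) (Fin k) (Op H)}
    (hM : 0 ≤ M) (i : Fin k) : 0 ≤ M i i := by
  rw [StarOrderedRing.nonneg_iff] at hM
  induction hM using AddSubmonoid.closure_induction with
  | mem x hx =>
    obtain ⟨B, rfl⟩ := hx
    simp only [CStarMatrix.mul_apply, CStarMatrix.star_apply]
    exact Finset.sum_nonneg fun j _ => star_mul_self_nonneg _
  | zero => exact le_rfl
  | add x y _ _ hx hy => exact add_nonneg hx hy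

namespace IsCP

variable {Φ : SuperOp H} (hΦ : IsCP Φ)
include hΦ

lemma map_nonneg {A : Op H} (hA : 0 ≤ A) : 0 ≤ Φ A := by
  obtain ⟨C, rfl⟩ := CStarAlgebra.nonneg_iff_eq_star_mul_self.1 hA
  have h := hΦ 1 _ (star_mul_self_nonneg (CStarMatrix.ofMatrix fun _ _ => C))
  have h' := CStarMatrix.apply_self_nonneg h 0
  simp only [CStarMatrix.map_apply, CStarMatrix.mul_apply, Finset.univ_unique,
    Finset.sum_singleton, CStarMatrix.star_apply] at h'
  exact h'

lemma map_star (A : Op H) : Φ (star A) = star (Φ A) := by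
  have h1 : ∀ B : Op H, IsSelfAdjoint B → IsSelfAdjoint (Φ B) := fun B hB => by
    rw [← CFC.posPart_sub_negPart B hB, map_sub]
    exact (IsSelfAdjoint.of_nonneg (hΦ.map_nonneg (CFC.posPart_nonneg B))).sub
      (IsSelfAdjoint.of_nonneg (hΦ.map_nonneg (CFC.negPart_nonneg B)))
  conv_lhs => rw [← realPart_add_I_smul_imaginaryPart A]
  conv_rhs => rw [← realPart_add_I_smul_imaginaryPart A]
  simp only [star_add, star_smul, map_add, map_smul, (h1 _ (realPart A).2).star_eq,
    (h1 _ (imaginaryPart A).2).star_eq, (realPart A).2.star_eq, (imaginaryPart A).2.star_eq]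

/-- The Kadison-Schwarz inequality, from positivity of `Φ` on the matrix
`[[X^* X, X^*], [X, 1]]`, conjugated by `[[1, 0], [-Φ(X), 0]]`. -/
lemma schwarz (h1 : Φ 1 = 1) (X : Op H) : 0 ≤ Φ (star X * X) - star (Φ X) * Φ X := by
  let A : CStarMatrix (Fin 2) (Fin 2) (Op H) := CStarMatrix.ofMatrix !![X, 1; 0, 0]
  let C : CStarMatrix (Fin 2) (Fin 2) (Op H) := CStarMatrix.ofMatrix !![1, 0; -Φ X, 0]
  have h := CStarMatrix.apply_self_nonneg
    (star_left_conjugate_nonneg (hΦ 2 _ (star_mul_self_nonneg A)) C) 0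
  simpa [A, C, CStarMatrix.mul_apply, CStarMatrix.star_apply, Fin.sum_univ_two, hΦ.map_star,
    h1] using h

/-- Choi's theorem: equality in the Kadison-Schwarz inequality for `X` makes `Φ` multiplicative
for left multiplication by `X^*`. -/
lemma map_star_mul_of_eq (h1 : Φ 1 = 1) {X : Op H} (hX : Φ (star X * X) = star (Φ X) * Φ X)
    (Y : Op H) : Φ (star X * Y) = star (Φ X) * Φ Y := by
  let D : Op H → Op H → Op H := fun Z W => Φ (star Z * W) - star (Φ Z) * Φ W
  have hD : ∀ Z W, star (D Z W) = D W Z := fun Z W => by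
    simp [D, ← hΦ.map_star]
  suffices h : ∀ v, inner ℂ v (D X Y v) = 0 by
    rw [← sub_eq_zero]
    change D X Y = 0
    refine ContinuousLinearMap.coe_injective ((inner_map_self_eq_zero _).1 fun v => ?_)
    rw [← inner_conj_symm]
    exact (congrArg _ (h v)).trans (map_zero _)
  intro v
  -- `(Z, W) ↦ ⟨v, D(Z, W) v⟩` is a positive semidefinite form: apply Cauchy-Schwarz.
  let c : PreInnerProductSpace.Core ℂ (Op H) :=
    { inner := fun Z W => inner ℂ v (D Z W v)
      conj_inner_symm := fun Z W => by
        rw [inner_conj_symm, ← hD, ContinuousLinearMap.star_eq_adjoint,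
          ContinuousLinearMap.adjoint_inner_left]
      re_inner_nonneg := fun Z => (Complex.nonneg_iff.1
        (((ContinuousLinearMap.nonneg_iff_isPositive _).1
          (hΦ.schwarz h1 Z)).inner_nonneg_right v)).1
      add_left := fun _ _ _ => by simp [D, add_mul]; ring
      smul_left := fun _ _ _ => by simp [D]; ring }
  have h := InnerProductSpace.Core.inner_mul_inner_self_le (c := c) X Y
  have hX0 : c.inner X X = 0 := by
    change inner ℂ v (D X X v) = 0
    simp [D, hX]
  have hsymm : ‖c.inner Y X‖ = ‖c.inner X Y‖ := by
    rw [← c.conj_inner_symm, RCLike.norm_conj]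
  change ‖c.inner X Y‖ * ‖c.inner Y X‖ ≤ RCLike.re (c.inner X X) * RCLike.re (c.inner Y Y) at h
  rw [hX0, hsymm, map_zero, zero_mul] at h
  exact norm_eq_zero.1 (mul_self_eq_zero.1 (le_antisymm h (mul_self_nonneg _)))

lemma map_mul_of_eq (h1 : Φ 1 = 1) {X : Op H} (hX : Φ (X * star X) = Φ X * star (Φ X))
    (Y : Op H) : Φ (X * Y) = Φ X * Φ Y := by
  simpa [hΦ.map_star] using
    hΦ.map_star_mul_of_eq h1 (X := star X) (by simpa [hΦ.map_star] using hX) Y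

end IsCP

/-- A completely positive unital map is a contraction for the operator norm. -/
lemma IsCP.norm_le_one {Φ : SuperOp H} (hΦ : IsCP Φ) (h1 : Φ 1 = 1) : ‖Φ‖ ≤ 1 := by
  refine ContinuousLinearMap.opNorm_le_bound _ zero_le_one fun X => ?_
  have hpos : ∀ A, 0 ≤ A → ‖Φ A‖ ≤ ‖A‖ := fun A hA => by
    have h := PositiveLinearMap.norm_apply_le_of_nonneg
      (PositiveLinearMap.mk₀ Φ.toLinearMap fun _ => hΦ.map_nonneg) A hA
    change ‖Φ A‖ ≤ ‖Φ 1‖ * ‖A‖ at h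
    rw [h1] at h
    exact h.trans (mul_le_of_le_one_left (norm_nonneg _) ContinuousLinearMap.norm_id_le)
  have h2 : ‖star (Φ X) * Φ X‖ ≤ ‖Φ (star X * X)‖ :=
    CStarAlgebra.norm_le_norm_of_nonneg_of_le (star_mul_self_nonneg _)
      (sub_nonneg.1 (hΦ.schwarz h1 X))
  have h3 := h2.trans (hpos _ (star_mul_self_nonneg X))
  rw [CStarRing.norm_star_mul_self, CStarRing.norm_star_mul_self] at h3
  rw [one_mul]
  exact le_of_not_gt fun h => (mul_self_lt_mul_self (norm_nonneg _) h).not_ge h3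

/-- The squared GNS norm `Tr[σ X^* X]`. -/
noncomputable def gnsSq (σ X : Op H) : ℝ := (tr (σ * (star X * X))).re

lemma continuous_tr : Continuous (tr : Op H → ℂ) := by
  have : (tr : Op H → ℂ) = fun X => ((LinearMap.trace ℂ H) ∘ₗ
      (ContinuousLinearMap.coeLM ℂ : Op H →ₗ[ℂ] H →ₗ[ℂ] H)) X := rfl
  rw [this]
  exact LinearMap.continuous_of_finiteDimensional _

lemma continuous_gnsSq (σ : Op H) : Continuous (gnsSq σ) := by
  unfold gnsSq
  exact Complex.continuous_re.comp (continuous_tr.comp (by fun_prop))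

lemma eq_zero_of_gnsSq {σ X : Op H} (hσ : IsStrictlyPositive σ) (h : gnsSq σ X = 0) :
    X = 0 := by
  have h0 := tr_mul_nonneg hσ.nonneg (star_mul_self_nonneg X)
  have h1 : tr (σ * (star X * X)) = 0 := Complex.ext h (Complex.nonneg_iff.1 h0).2.symm
  simpa using eq_zero_of_tr_mul_eq_zero hσ (star_mul_self_nonneg X) h1

/-- A completely positive unital map preserving the state `σ` contracts the GNS norm. -/
lemma IsCP.gnsSq_map_le {Φ : SuperOp H} (hΦ : IsCP Φ) (h1 : Φ 1 = 1) {σ : Op H} (hσ : 0 ≤ σ)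
    (hinv : ∀ X, tr (σ * Φ X) = tr (σ * X)) (X : Op H) : gnsSq σ (Φ X) ≤ gnsSq σ X := by
  have h := (Complex.nonneg_iff.1 (tr_mul_nonneg hσ (hΦ.schwarz h1 X))).1
  rw [mul_sub, tr_sub, hinv, Complex.sub_re] at h
  exact sub_nonneg.1 h

/-- A completely positive unital map that preserves a faithful state and does not decrease the GNS
norm of `X` attains equality in the Kadison-Schwarz inequality. -/
lemma IsCP.map_star_mul_self_of_gnsSq_le {Φ : SuperOp H} (hΦ : IsCP Φ) (h1 : Φ 1 = 1) {σ : Op H}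
    (hσ : IsStrictlyPositive σ) (hinv : ∀ X, tr (σ * Φ X) = tr (σ * X)) {X : Op H}
    (h : gnsSq σ X ≤ gnsSq σ (Φ X)) : Φ (star X * X) = star (Φ X) * Φ X := by
  have h0 := hΦ.schwarz h1 X
  have h2 := Complex.nonneg_iff.1 (tr_mul_nonneg hσ.nonneg h0)
  refine sub_eq_zero.1 (eq_zero_of_tr_mul_eq_zero hσ h0 (Complex.ext (le_antisymm ?_ h2.1)
    h2.2.symm))
  rw [mul_sub, tr_sub, hinv, Complex.sub_re]
  exact sub_nonpos.2 h

lemma isClosed_setOf_isCP : IsClosed {Φ : SuperOp H | IsCP Φ} := by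
  simp only [IsCP, ofPred_forall]
  refine isClosed_iInter fun k => isClosed_iInter fun M => isClosed_iInter fun _ => ?_
  have hc : Continuous fun Φ : SuperOp H => M.map Φ :=
    continuous_pi fun i => continuous_pi fun j =>
      (ContinuousLinearMap.apply ℂ (Op H) (M i j)).continuous
  exact (CStarAlgebra.isClosed_nonneg (A := CStarMatrix (Fin k) (Fin k) (Op H))).preimage hc

/-! ### The decoherence-free algebra -/

namespace IsQMS

variable {P : ℝ → SuperOp H} (hP : IsQMS P)
include hP

lemma mem_dfAlgebra_iff {X : Op H} : X ∈ dfAlgebra P ↔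
    ∀ t : ℝ, 0 ≤ t → ∀ Y : Op H, P t (X * Y) = P t X * P t Y ∧ P t (Y * X) = P t Y * P t X := by
  refine forall₂_congr fun t ht => ⟨fun h Y => ?_, fun h Y => ?_⟩
  · have h1 := congrArg star (h (star Y)).2
    have h2 := congrArg star (h (star Y)).1
    simp only [← (hP.cp t ht).map_star, star_mul, star_star] at h1 h2
    exact ⟨h1, h2⟩
  · have h1 := congrArg star (h (star Y)).2
    have h2 := congrArg star (h (star Y)).1
    simp only [← (hP.cp t ht).map_star, star_mul, star_star] at h1 h2
    simp only [← (hP.cp t ht).map_star]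
    exact ⟨h1, h2⟩

/-- Equality in the Kadison-Schwarz inequality for `X` and `X^*` puts `X` into `N(P)`. -/
lemma mem_dfAlgebra_of_eq {X : Op H}
    (h1 : ∀ t : ℝ, 0 ≤ t → P t (star X * X) = star (P t X) * P t X)
    (h2 : ∀ t : ℝ, 0 ≤ t → P t (X * star X) = P t X * star (P t X)) : X ∈ dfAlgebra P := by
  intro t ht Y
  have hcp := hP.cp t ht
  refine ⟨hcp.map_star_mul_of_eq (hP.unital t ht) (h1 t ht) Y, ?_⟩
  have h := congrArg star (hcp.map_mul_of_eq (hP.unital t ht) (h2 t ht) (star Y))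
  simpa [← hcp.map_star] using h

/-- `N(P)` as a star subalgebra of `B(H)`. -/
def dfSubalgebra : StarSubalgebra ℂ (Op H) where
  carrier := dfAlgebra P
  mul_mem' {X Z} hX hZ := by
    rw [hP.mem_dfAlgebra_iff] at *
    intro t ht Y
    constructor
    · rw [mul_assoc, (hX t ht _).1, (hZ t ht _).1, (hX t ht _).1, mul_assoc]
    · rw [← mul_assoc, (hZ t ht _).2, (hX t ht _).2, (hX t ht _).1, mul_assoc]
  add_mem' {X Z} hX hZ := by
    rw [hP.mem_dfAlgebra_iff] at *
    intro t ht Y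
    simp [add_mul, mul_add, hX t ht Y, hZ t ht Y]
  algebraMap_mem' r := by
    rw [hP.mem_dfAlgebra_iff]
    intro t ht Y
    simp [Algebra.algebraMap_eq_smul_one, hP.unital t ht]
  star_mem' {X} hX := by
    rw [hP.mem_dfAlgebra_iff]
    intro t ht Y
    have h := hX t ht Y
    rwa [← (hP.cp t ht).map_star] at h

lemma isClosed_dfAlgebra : IsClosed (dfAlgebra P) :=
  Submodule.closed_of_finiteDimensional hP.dfSubalgebra.toSubalgebra.toSubmodule

lemma map_star_mul {X : Op H} (hX : X ∈ dfAlgebra P) {t : ℝ} (ht : 0 ≤ t) (Y : Op H) :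
    P t (star X * Y) = star (P t X) * P t Y := (hX t ht Y).1

/-- Each `P t` maps `N(P)` into itself. -/
lemma map_mem_dfAlgebra {X : Op H} (hX : X ∈ dfAlgebra P) {t : ℝ} (ht : 0 ≤ t) :
    P t X ∈ dfAlgebra P := by
  have hadd : ∀ s, 0 ≤ s → ∀ Y, P s (P t Y) = P (s + t) Y := fun s hs Y => by
    rw [hP.map_add s t hs ht]; rfl
  refine hP.mem_dfAlgebra_of_eq (fun s hs => ?_) fun s hs => ?_
  · rw [← (hX t ht X).1, hadd s hs, hadd s hs, (hX _ (add_nonneg hs ht) X).1]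
  · rw [← (hX t ht X).2, hadd s hs, hadd s hs, (hX _ (add_nonneg hs ht) X).2]

variable {σ : Op H} (hσ : IsFaithfulState σ) (hinv : IsInvariant P σ)
include hinv

lemma gnsSq_map {X : Op H} (hX : X ∈ dfAlgebra P) {t : ℝ} (ht : 0 ≤ t) :
    gnsSq σ (P t X) = gnsSq σ X := by
  rw [gnsSq, ← (hX t ht X).1, hinv t ht, gnsSq]

include hσ

lemma gnsSq_map_le (X : Op H) {t : ℝ} (ht : 0 ≤ t) : gnsSq σ (P t X) ≤ gnsSq σ X :=
  (hP.cp t ht).gnsSq_map_le (hP.unital t ht) hσ.pos.nonneg (hinv t ht) X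

/-- An element whose GNS norm, and that of its adjoint, does not decrease lies in `N(P)`. -/
lemma mem_dfAlgebra_of_gnsSq_le {X : Op H} (h1 : ∀ t, 0 ≤ t → gnsSq σ X ≤ gnsSq σ (P t X))
    (h2 : ∀ t, 0 ≤ t → gnsSq σ (star X) ≤ gnsSq σ (P t (star X))) : X ∈ dfAlgebra P := by
  refine hP.mem_dfAlgebra_of_eq (fun t ht => ?_) fun t ht => ?_
  · exact (hP.cp t ht).map_star_mul_self_of_gnsSq_le (hP.unital t ht) hσ.pos (hinv t ht) (h1 t ht)
  · simpa [(hP.cp t ht).map_star] using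
      (hP.cp t ht).map_star_mul_self_of_gnsSq_le (hP.unital t ht) hσ.pos (hinv t ht) (h2 t ht)

/-- `P t` permutes `N(P)`. -/
lemma exists_map_eq {X : Op H} (hX : X ∈ dfAlgebra P) {t : ℝ} (ht : 0 ≤ t) :
    ∃ Y ∈ dfAlgebra P, P t Y = X := by
  let V := hP.dfSubalgebra.toSubalgebra.toSubmodule
  let f : V →ₗ[ℂ] V := (P t).toLinearMap.restrict fun _ hY => hP.map_mem_dfAlgebra hY ht
  have hf : Function.Injective f := by
    rw [injective_iff_map_eq_zero]
    intro Y hY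
    have h0 : P t Y = 0 := congrArg Subtype.val hY
    have h := hP.gnsSq_map hinv Y.2 ht
    rw [h0] at h
    exact Subtype.ext (eq_zero_of_gnsSq hσ.pos (h.symm.trans (by simp [gnsSq, tr_zero])))
  obtain ⟨Y, hY⟩ := LinearMap.injective_iff_surjective.1 hf ⟨X, hX⟩
  exact ⟨Y, Y.2, congrArg Subtype.val hY⟩

/-! ### Existence of the conditional expectation -/

open Filter in
/-- The set of limit points of `P t` as `t → ∞` is a compact semigroup, so it contains an
idempotent, and this idempotent is the conditional expectation onto `N(P)`. -/
lemma exists_isDFCondExp : ∃ E, IsDFCondExp P σ E := by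
  let S : Set (SuperOp H) := {Q | MapClusterPt Q atTop P}
  have hball : ∀ t, 0 ≤ t → P t ∈ Metric.closedBall (0 : SuperOp H) 1 := fun t ht => by
    simpa using (hP.cp t ht).norm_le_one (hP.unital t ht)
  have hmem : ∀ {Q C}, Q ∈ S → IsClosed C → (∀ᶠ t in atTop, P t ∈ C) → Q ∈ C :=
    fun hQ hC h => hC.mem_of_mapClusterPt hQ h
  have hcpt : IsCompact (Metric.closedBall (0 : SuperOp H) 1) := isCompact_closedBall _ _
  have hne : S.Nonempty := by
    obtain ⟨Q, -, hQ⟩ := hcpt.exists_mapClusterPt (f := atTop) (u := P)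
      (by simpa using (eventually_ge_atTop 0).mono hball)
    exact ⟨Q, hQ⟩
  have hclosed : IsClosed S := isClosed_setOfPred_clusterPt
  have hS : IsCompact S := hcpt.of_isClosed_subset hclosed fun Q hQ =>
    hmem hQ Metric.isClosed_closedBall ((eventually_ge_atTop 0).mono hball)
  have hmulP : ∀ s, 0 ≤ s → ∀ R ∈ S, P s * R ∈ S := fun s hs R hR => by
    have h1 : MapClusterPt (P s * R) atTop (fun t => P s * P t) :=
      MapClusterPt.continuousAt_comp (f := fun R => P s * R)
        (continuous_const_mul (P s)).continuousAt hR
    have h2 : MapClusterPt (P s * R) atTop (P ∘ fun t => s + t) :=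
      h1.congrFun ((eventually_ge_atTop 0).mono fun t ht => (hP.map_add s t hs ht).symm)
    exact h2.of_comp (tendsto_atTop_add_const_left _ _ tendsto_id)
  obtain ⟨Q, hQ, hQQ⟩ := exists_idempotent_in_compact_subsemigroup
    (fun R => continuous_mul_const R) S hne hS fun Q hQ R hR =>
      hmem (C := (· * R) ⁻¹' S) hQ (hclosed.preimage (continuous_mul_const R))
        ((eventually_ge_atTop 0).mono fun s hs => hmulP s hs R hR)
  have happ : ∀ X, Continuous fun Φ : SuperOp H => Φ X := fun X =>
    (ContinuousLinearMap.apply ℂ (Op H) X).continuous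
  have hQcp : IsCP Q :=
    hmem hQ (isClosed_setOf_isCP) ((eventually_ge_atTop 0).mono hP.cp)
  have hidem : ∀ X, Q (Q X) = Q X := fun X => DFunLike.congr_fun hQQ X
  refine ⟨Q, hQcp, hidem, Subset.antisymm ?_ fun X hX => ⟨X, ?_⟩, fun X => ?_⟩
  · have key : ∀ X, Q X = X → ∀ t, 0 ≤ t → gnsSq σ X ≤ gnsSq σ (P t X) := fun X hX t ht => by
      have h : Q ∈ {Φ : SuperOp H | gnsSq σ (Φ X) ≤ gnsSq σ (P t X)} :=
        hmem hQ (isClosed_le ((continuous_gnsSq σ).comp (happ X)) continuous_const)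
          ((eventually_ge_atTop t).mono fun s hs => by
            have := hP.map_add (s - t) t (sub_nonneg.2 hs) ht
            rw [sub_add_cancel] at this
            simpa [this] using hP.gnsSq_map_le hσ hinv (P t X) (sub_nonneg.2 hs))
      simpa [hX] using h
    rintro _ ⟨X, rfl⟩
    exact hP.mem_dfAlgebra_of_gnsSq_le hσ hinv (key _ (hidem X))
      (key _ (by rw [← hQcp.map_star, hidem]))
  · have hmemN : ∀ Y ∈ dfAlgebra P, Q Y ∈ dfAlgebra P := fun Y hY =>
      hmem (C := {Φ : SuperOp H | Φ Y ∈ dfAlgebra P}) hQ (hP.isClosed_dfAlgebra.preimage (happ Y))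
        ((eventually_ge_atTop 0).mono fun t ht => hP.map_mem_dfAlgebra hY ht)
    have hiso : ∀ Y ∈ dfAlgebra P, gnsSq σ (Q Y) = gnsSq σ Y := fun Y hY =>
      hmem (C := {Φ : SuperOp H | gnsSq σ (Φ Y) = gnsSq σ Y}) hQ
        (isClosed_eq ((continuous_gnsSq σ).comp (happ Y)) continuous_const)
        ((eventually_ge_atTop 0).mono fun t ht => hP.gnsSq_map hinv hY ht)
    have h := hiso (X - Q X) (hP.dfSubalgebra.sub_mem hX (hmemN X hX))
    rw [map_sub, hidem, sub_self] at h
    exact (sub_eq_zero.1 (eq_zero_of_gnsSq hσ.pos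
      (h.symm.trans (by simp [gnsSq, tr_zero])))).symm
  · exact hmem (C := {Φ : SuperOp H | tr (σ * Φ X) = tr (σ * X)}) hQ
      (isClosed_eq (continuous_tr.comp (continuous_const.mul (happ X))) continuous_const)
      ((eventually_ge_atTop 0).mono fun t ht => hinv t ht X)

end IsQMS

/-! ### The conditional expectation and the reference state -/

lemma finrank_ne_zero {σ : Op H} (hσ : IsFaithfulState σ) : Module.finrank ℂ H ≠ 0 := fun h => by
  have := Module.finrank_zero_iff.1 h
  have h0 : σ = 0 := Subsingleton.elim _ _
  have h1 := hσ.tr_eq_one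
  rw [h0, tr_zero] at h1
  exact zero_ne_one h1

namespace IsQMS

variable {P : ℝ → SuperOp H} (hP : IsQMS P) {σ : Op H} (hσ : IsFaithfulState σ)
  (hinv : IsInvariant P σ)
include hP hσ hinv

lemma isDFCondExp_condExp : IsDFCondExp P σ (condExp P σ) := by
  have h := hP.exists_isDFCondExp hσ hinv
  rw [condExp, dif_pos h]
  exact h.choose_spec

lemma condExp_mem (X : Op H) : condExp P σ X ∈ dfAlgebra P := by
  rw [← (hP.isDFCondExp_condExp hσ hinv).range_eq]
  exact mem_range_self X

lemma condExp_of_mem {X : Op H} (hX : X ∈ dfAlgebra P) : condExp P σ X = X := by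
  rw [← (hP.isDFCondExp_condExp hσ hinv).range_eq] at hX
  obtain ⟨Y, rfl⟩ := hX
  exact (hP.isDFCondExp_condExp hσ hinv).idem Y

lemma condExp_star (X : Op H) : condExp P σ (star X) = star (condExp P σ X) :=
  (hP.isDFCondExp_condExp hσ hinv).cp.map_star X

lemma condExp_one : condExp P σ 1 = 1 :=
  hP.condExp_of_mem hσ hinv hP.dfSubalgebra.one_mem

/-- `E_N` is a left module map over `N(P)`, because `N(P)` lies in its multiplicative domain. -/
lemma condExp_mul_left {X : Op H} (hX : X ∈ dfAlgebra P) (Y : Op H) :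
    condExp P σ (X * Y) = X * condExp P σ Y := by
  have hXs : X * star X ∈ dfAlgebra P :=
    hP.dfSubalgebra.mul_mem hX (hP.dfSubalgebra.star_mem' hX)
  have h := (hP.isDFCondExp_condExp hσ hinv).cp.map_mul_of_eq (hP.condExp_one hσ hinv) (X := X)
    (by rw [hP.condExp_of_mem hσ hinv hX, hP.condExp_of_mem hσ hinv hXs]) Y
  rwa [hP.condExp_of_mem hσ hinv hX] at h

lemma condExp_mul_right {X : Op H} (hX : X ∈ dfAlgebra P) (Y : Op H) :
    condExp P σ (Y * X) = condExp P σ Y * X := by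
  have h := congrArg star
    (hP.condExp_mul_left hσ hinv (hP.dfSubalgebra.star_mem' hX) (star Y))
  simpa [← hP.condExp_star hσ hinv] using h

/-- The kernel of `E_N` is invariant under `P t`: it is the GNS-orthogonal complement of `N(P)`,
and `P t` permutes `N(P)`. -/
lemma condExp_map_eq_zero {X : Op H} (hX : condExp P σ X = 0) {t : ℝ} (ht : 0 ≤ t) :
    condExp P σ (P t X) = 0 := by
  have hE := hP.isDFCondExp_condExp hσ hinv
  set Z := condExp P σ (P t X)
  have hZ : Z ∈ dfAlgebra P := hP.condExp_mem hσ hinv _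
  obtain ⟨W, hW, hWZ⟩ := hP.exists_map_eq hσ hinv hZ ht
  have hs : ∀ {A}, A ∈ dfAlgebra P → star A ∈ dfAlgebra P := fun h => hP.dfSubalgebra.star_mem' h
  have h : tr (σ * (star Z * Z)) = 0 := by
    calc tr (σ * (star Z * Z)) = tr (σ * (star (P t W) * P t X)) := by
          rw [← hP.condExp_mul_left hσ hinv (hs hZ), hE.compatible, hWZ]
      _ = tr (σ * (star W * X)) := by rw [← hP.map_star_mul hW ht, hinv t ht]
      _ = 0 := by
          rw [← hE.compatible, hP.condExp_mul_left hσ hinv (hs hW), hX, mul_zero, mul_zero,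
            tr_zero]
  simpa using eq_zero_of_tr_mul_eq_zero hσ.pos (star_mul_self_nonneg Z) h

lemma condExp_map (X : Op H) {t : ℝ} (ht : 0 ≤ t) :
    condExp P σ (P t X) = P t (condExp P σ X) := by
  have h0 : condExp P σ (X - condExp P σ X) = 0 := by
    rw [map_sub, (hP.isDFCondExp_condExp hσ hinv).idem, sub_self]
  have h := hP.condExp_map_eq_zero hσ hinv h0 ht
  rw [map_sub, map_sub, sub_eq_zero] at h
  rw [h, hP.condExp_of_mem hσ hinv (hP.map_mem_dfAlgebra (hP.condExp_mem hσ hinv X) ht)]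

omit hP hσ hinv in
lemma tr_mul_sigmaTr (X : Op H) :
    tr (X * sigmaTr P σ) = (Module.finrank ℂ H : ℂ)⁻¹ * tr (condExp P σ X) := by
  rw [sigmaTr, ← tr_map_mul, mul_smul_comm, mul_one, tr_smul]

omit hP hσ hinv in
lemma inner_sigmaTr (v : H) : inner ℂ v (sigmaTr P σ v) =
    (Module.finrank ℂ H : ℂ)⁻¹ * tr (condExp P σ (InnerProductSpace.rankOne ℂ v v)) := by
  rw [← tr_mul_sigmaTr, tr_mul_comm]
  have h : sigmaTr P σ * InnerProductSpace.rankOne ℂ v v =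
      InnerProductSpace.rankOne ℂ (sigmaTr P σ v) v := by
    ext w
    simp [InnerProductSpace.rankOne_apply]
  rw [h, tr, InnerProductSpace.trace_rankOne]

lemma tr_condExp_nonneg {X : Op H} (hX : 0 ≤ X) :
    0 ≤ (Module.finrank ℂ H : ℂ)⁻¹ * tr (condExp P σ X) :=
  mul_nonneg (by positivity) (tr_nonneg ((hP.isDFCondExp_condExp hσ hinv).cp.map_nonneg hX))

lemma sigmaTr_nonneg : 0 ≤ sigmaTr P σ := by
  rw [ContinuousLinearMap.nonneg_iff_isPositive, ContinuousLinearMap.isPositive_iff_complex]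
  intro v
  have h := hP.tr_condExp_nonneg hσ hinv
    ((ContinuousLinearMap.nonneg_iff_isPositive _).2 (InnerProductSpace.isPositive_rankOne_self v))
  rw [← inner_sigmaTr] at h
  rw [← inner_conj_symm]
  generalize inner ℂ v (sigmaTr P σ v) = z at h
  obtain ⟨hre, him⟩ := Complex.nonneg_iff.1 h
  exact ⟨Complex.ext (by simp) (by simp [← him]), by simpa using hre⟩

lemma isStrictlyPositive_sigmaTr : IsStrictlyPositive (sigmaTr P σ) := by
  refine IsStrictlyPositive.iff_of_unital.2 ⟨hP.sigmaTr_nonneg hσ hinv, ?_⟩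
  have hinj : Function.Injective (sigmaTr P σ) := by
    rw [injective_iff_map_eq_zero]
    intro v hv
    have hE := hP.isDFCondExp_condExp hσ hinv
    have hv0 : 0 ≤ InnerProductSpace.rankOne ℂ v v :=
      (ContinuousLinearMap.nonneg_iff_isPositive _).2 (InnerProductSpace.isPositive_rankOne_self v)
    have h := inner_sigmaTr (P := P) (σ := σ) v
    rw [hv, inner_zero_right, eq_comm, mul_eq_zero, or_iff_right (by
      simpa using finrank_ne_zero hσ)] at h
    have h1 := hE.compatible (InnerProductSpace.rankOne ℂ v v)
    rw [eq_zero_of_tr_eq_zero (hE.cp.map_nonneg hv0) h, mul_zero, tr_zero] at h1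
    simpa using eq_zero_of_tr_mul_eq_zero hσ.pos hv0 h1.symm
  rw [ContinuousLinearMap.isUnit_iff_bijective]
  exact ⟨hinj, (LinearMap.injective_iff_surjective (f := (sigmaTr P σ).toLinearMap)).1 hinj⟩

/-- `σ_Tr` commutes with `N(P)`: for `X ∈ N(P)`, `Tr[X E_N(Y)] = Tr[E_N(Y) X]`. -/
lemma commute_sigmaTr {X : Op H} (hX : X ∈ dfAlgebra P) : Commute (sigmaTr P σ) X := by
  have h : ∀ Z : Op H, tr (Z * (sigmaTr P σ * X - X * sigmaTr P σ)) = 0 := fun Z => by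
    rw [mul_sub, tr_sub, ← mul_assoc, tr_mul_comm, ← mul_assoc, ← mul_assoc, tr_mul_sigmaTr,
      tr_mul_sigmaTr, hP.condExp_mul_left hσ hinv hX, hP.condExp_mul_right hσ hinv hX,
      tr_mul_comm, sub_self]
  exact sub_eq_zero.1 (eq_zero_of_tr_star_mul_self (h _))

/-- On `N(P)` the scalar product is the normalized Hilbert-Schmidt one. -/
lemma kms_of_mem_left {X : Op H} (hX : X ∈ dfAlgebra P) (Y : Op H) :
    kms (sigmaTr P σ) X Y = (Module.finrank ℂ H : ℂ)⁻¹ * tr (star X * condExp P σ Y) := by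
  have hXs : star X ∈ dfAlgebra P := hP.dfSubalgebra.star_mem' hX
  have hc : Commute (CFC.sqrt (sigmaTr P σ)) (star X) :=
    (hP.commute_sigmaTr hσ hinv hXs).cfcₙ_nnreal _
  rw [kms, hc.eq, mul_assoc (star X), sqrt_mul_sqrt (hP.sigmaTr_nonneg hσ hinv),
    tr_mul_comm, ← mul_assoc, tr_mul_sigmaTr, hP.condExp_mul_right hσ hinv hXs, tr_mul_comm]

/-- `E_N` is the orthogonal projection onto `N(P)` for `⟨·,·⟩_{σ_Tr}`. -/
lemma kms_sub_condExp {X : Op H} (hX : X ∈ dfAlgebra P) (Y : Op H) :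
    kms (sigmaTr P σ) X (Y - condExp P σ Y) = 0 := by
  rw [hP.kms_of_mem_left hσ hinv hX, map_sub, (hP.isDFCondExp_condExp hσ hinv).idem, sub_self,
    mul_zero, tr_zero, mul_zero]

end IsQMS

/-! ### Differentiability of the semigroup -/

open MeasureTheory intervalIntegral Filter in
/-- A norm-continuous one-parameter semigroup in a Banach algebra is differentiable: with
`F t = ∫_0^t p`, `F h` is invertible for small `h > 0` and `p t = (F (t + h) - F t) (F h)⁻¹`. -/
lemma exists_hasDerivWithinAt_of_semigroup {A : Type*} [NormedRing A] [NormedAlgebra ℝ A]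
    [CompleteSpace A] {p : ℝ → A} (h0 : p 0 = 1)
    (hadd : ∀ s t, 0 ≤ s → 0 ≤ t → p (s + t) = p s * p t) (hc : ContinuousOn p (Ici 0)) :
    ∃ p' : ℝ → A, ∀ t, 0 ≤ t → HasDerivWithinAt p (p' t) (Ici 0) t := by
  let q : ℝ → A := fun t => p (max t 0)
  have hq : Continuous q :=
    hc.comp_continuous (continuous_id.max continuous_const) fun t =>
      mem_Ici.2 (le_max_right _ _)
  have hqp : ∀ t, 0 ≤ t → q t = p t := fun t ht => by simp [q, ht]
  let F : ℝ → A := fun t => ∫ s in (0 : ℝ)..t, q s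
  have hF : ∀ t, HasDerivAt F (q t) t := fun t =>
    integral_hasDerivAt_right (hq.intervalIntegrable _ _)
      hq.stronglyMeasurable.stronglyMeasurableAtFilter hq.continuousAt
  have hshift : ∀ t h, 0 ≤ t → 0 ≤ h → p t * F h = F (t + h) - F t := fun t h ht hh => by
    have h1 : ∫ s in (0 : ℝ)..h, p t * q s = ∫ s in (0 : ℝ)..h, q (t + s) := by
      refine integral_congr fun s hs => ?_
      rw [uIcc_of_le hh] at hs
      simp only [hqp s hs.1, hqp (t + s) (add_nonneg ht hs.1), hadd t s ht hs.1]
    have h2 := ((ContinuousLinearMap.mul ℝ A) (p t)).intervalIntegral_comp_comm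
      (hq.intervalIntegrable (μ := volume) 0 h)
    simp only [ContinuousLinearMap.mul_apply'] at h2
    rw [← h2, h1, integral_comp_add_left, add_zero, integral_interval_sub_left]
    · exact hq.intervalIntegrable _ _
    · exact hq.intervalIntegrable _ _
  obtain ⟨h, hh, u, hu⟩ : ∃ h : ℝ, 0 < h ∧ IsUnit (h⁻¹ • F h) := by
    have ht : Tendsto (fun h : ℝ => h⁻¹ • F h) (nhdsWithin 0 {0}ᶜ) (nhds 1) := by
      have := (hasDerivAt_iff_tendsto_slope_zero.1 (hF 0))
      simpa [F, q, h0] using this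
    have h1 := (ht.mono_left (nhdsWithin_mono (0 : ℝ)
      (show Ioi (0 : ℝ) ⊆ {0}ᶜ from fun x hx => ne_of_gt hx))).eventually
      (Units.isOpen.mem_nhds (show IsUnit (1 : A) from isUnit_one))
    obtain ⟨h, h2, h3⟩ := (h1.and (eventually_mem_nhdsWithin (a := (0 : ℝ)) (s := Ioi 0))).exists
    exact ⟨h, h3, h2⟩
  have hG : ∀ t, 0 ≤ t → p t = (h⁻¹ • (F (t + h) - F t)) * ↑u⁻¹ := fun t ht => by
    rw [← hshift t h ht hh.le, ← mul_smul_comm, ← hu, mul_assoc, Units.mul_inv, mul_one]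
  refine ⟨fun t => (h⁻¹ • (q (t + h) - q t)) * ↑u⁻¹, fun t ht => ?_⟩
  have hd : HasDerivAt (fun t => (h⁻¹ • (F (t + h) - F t)) * ↑u⁻¹)
      ((h⁻¹ • (q (t + h) - q t)) * ↑u⁻¹) t :=
    ((((hF (t + h)).comp_add_const t h).sub (hF t)).const_smul h⁻¹).mul_const _
  exact hd.hasDerivWithinAt.congr (fun s hs => hG s hs) (hG t ht)

namespace IsQMS

variable {P : ℝ → SuperOp H} (hP : IsQMS P)
include hP

lemma hasDerivWithinAt {t : ℝ} (ht : 0 ≤ t) :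
    HasDerivWithinAt P (P t * generator P) (Ici 0) t := by
  obtain ⟨p', hp'⟩ := exists_hasDerivWithinAt_of_semigroup (p := P) hP.map_zero
    (fun s t hs ht => hP.map_add s t hs ht) hP.cont
  have h0 : HasDerivWithinAt P (generator P) (Ici 0) 0 :=
    (hp' 0 le_rfl).differentiableWithinAt.hasDerivWithinAt
  -- Compare right derivatives at `t`, where `P s = P t * P (s - t)`.
  have h1 : HasDerivWithinAt (fun s => P t * P (s - t)) (P t * generator P) (Ici t) t := by
    have h2 : HasDerivWithinAt (fun s => P (s - t)) (generator P) (Ici t) t := by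
      have := HasDerivWithinAt.scomp (g₁ := P) (h := fun s => s - t) (x := t) (s := Ici t)
        (t' := Ici 0) (h' := 1) (g₁' := generator P) (by simpa using h0)
        ((hasDerivAt_id t).sub_const t).hasDerivWithinAt
        (fun s hs => sub_nonneg.2 hs)
      simpa [Function.comp_def] using this
    exact h2.const_mul (P t)
  have h3 : HasDerivWithinAt P (P t * generator P) (Ici t) t := by
    have heq : ∀ s ∈ Ici t, P s = P t * P (s - t) := fun s hs => by
      have := hP.map_add t (s - t) ht (sub_nonneg.2 hs)
      rwa [add_sub_cancel] at this
    exact h1.congr heq (heq t self_mem_Ici)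
  have h4 := (hp' t ht).mono (Ici_subset_Ici.2 ht)
  rw [(uniqueDiffOn_Ici t t self_mem_Ici).eq_deriv _ h3 h4]
  exact hp' t ht

lemma hasDerivWithinAt_apply (X : Op H) {t : ℝ} (ht : 0 ≤ t) :
    HasDerivWithinAt (fun t => P t X) (P t (generator P X)) (Ici 0) t :=
  (((ContinuousLinearMap.apply ℂ (Op H) X).restrictScalars ℝ).hasFDerivAt.comp_hasDerivWithinAt t
    (hP.hasDerivWithinAt ht))

lemma map_generator_comm (X : Op H) {t : ℝ} (ht : 0 ≤ t) :
    P t (generator P X) = generator P (P t X) := by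
  have h1 : HasDerivWithinAt (fun s => P t (P s X)) (P t (generator P X)) (Ici 0) 0 := by
    have := ((P t).restrictScalars ℝ).hasFDerivAt.comp_hasDerivWithinAt 0
      (hP.hasDerivWithinAt_apply X le_rfl)
    simpa [hP.map_zero, Function.comp_def] using this
  have h2 := hP.hasDerivWithinAt_apply (P t X) le_rfl
  have h3 : ∀ s ∈ Ici (0 : ℝ), P s (P t X) = P t (P s X) := fun s hs => by
    have h4 := hP.map_add s t hs ht
    rw [add_comm, hP.map_add t s ht hs] at h4
    exact (DFunLike.congr_fun h4 X).symm
  have h5 := h1.congr h3 (h3 0 self_mem_Ici)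
  rw [(uniqueDiffOn_Ici 0 0 self_mem_Ici).eq_deriv _ h5 h2]
  simp [hP.map_zero]

lemma hasDerivWithinAt_apply' (X : Op H) {t : ℝ} (ht : 0 ≤ t) :
    HasDerivWithinAt (fun t => P t X) (generator P (P t X)) (Ici 0) t := by
  rw [← hP.map_generator_comm X ht]
  exact hP.hasDerivWithinAt_apply X ht

lemma hasDerivWithinAt_zero (X : Op H) :
    HasDerivWithinAt (fun t => P t X) (generator P X) (Ici 0) 0 := by
  simpa [hP.map_zero] using hP.hasDerivWithinAt_apply X le_rfl

lemma generator_star (X : Op H) : generator P (star X) = star (generator P X) := by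
  have h1 := (hP.hasDerivWithinAt_zero X).star
  have h2 := (hP.hasDerivWithinAt_zero (star X)).congr_of_mem (f₁ := fun t => star (P t X))
    (fun t ht => ((hP.cp t ht).map_star X).symm) self_mem_Ici
  exact (uniqueDiffOn_Ici 0 0 self_mem_Ici).eq_deriv _ h2 h1

lemma generator_one : generator P 1 = 0 := by
  have h2 := (hP.hasDerivWithinAt_zero 1).congr_of_mem (f₁ := fun _ => (1 : Op H))
    (fun t ht => (hP.unital t ht).symm) self_mem_Ici
  exact (uniqueDiffOn_Ici 0 0 self_mem_Ici).eq_deriv _ h2 (hasDerivWithinAt_const _ _ _)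

/-- `L` acts as a derivation on products with left factor in `N(P)`. -/
lemma generator_mul {X : Op H} (hX : X ∈ dfAlgebra P) (Y : Op H) :
    generator P (X * Y) = generator P X * Y + X * generator P Y := by
  have h1 := (hP.hasDerivWithinAt_zero X).mul (hP.hasDerivWithinAt_zero Y)
  have h2 := (hP.hasDerivWithinAt_zero (X * Y)).congr_of_mem (f₁ := fun t => P t X * P t Y)
    (fun t ht => ((hP.mem_dfAlgebra_iff.1 hX t ht Y).1).symm) self_mem_Ici
  have h3 := (uniqueDiffOn_Ici 0 0 self_mem_Ici).eq_deriv _ h2 h1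
  simpa [hP.map_zero] using h3

/-- For `X ∈ N(P)` and a polynomial `q`, the derivation property gives
`Tr[L(q(X))] = Tr[q'(X) L(X)]`. -/
lemma tr_generator_aeval {X : Op H} (hX : X ∈ dfAlgebra P) (q : Polynomial ℂ) :
    tr (generator P (Polynomial.aeval X q)) =
      tr (Polynomial.aeval X (Polynomial.derivative q) * generator P X) := by
  induction q using Polynomial.induction_on' with
  | add p q hp hq => simp [add_mul, tr_add, hp, hq]
  | monomial n a =>
    have key : ∀ (n : ℕ) (Y : Op H), Commute X Y →
        tr (Y * generator P (X ^ n)) = n * tr (Y * X ^ (n - 1) * generator P X) := by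
      intro n
      induction n with
      | zero => intro Y _; simp [hP.generator_one, tr_zero]
      | succ n ih =>
        intro Y hY
        rw [pow_succ', hP.generator_mul hX, mul_add, tr_add, ← mul_assoc Y X,
          ih _ (hY.mul_right (Commute.refl X)), ← mul_assoc, tr_mul_comm, ← mul_assoc,
          (hY.symm.pow_right n).symm.eq]
        rcases n with _ | n
        · simp
        · simp only [Nat.add_sub_cancel, mul_assoc Y X, ← pow_succ']
          push_cast
          ring
    have := key n 1 (Commute.one_right X)
    simp only [one_mul] at this
    simp [Polynomial.aeval_monomial, Polynomial.derivative_monomial,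
      Algebra.algebraMap_eq_smul_one, tr_smul, this, mul_assoc]

/-- The trace is stationary on selfadjoint elements of `N(P)`. The minimal polynomial `m` of `X`
is squarefree, so that `r m' + s m = 1` for some `r, s`; then `Q = X - r m` satisfies `Q(X) = X`
and `Q'(X) = 0`, whence `Tr[L(X)] = Tr[L(Q(X))] = Tr[Q'(X) L(X)] = 0`. -/
lemma tr_generator_of_isSelfAdjoint {X : Op H} (hX : X ∈ dfAlgebra P) (hXs : IsSelfAdjoint X) :
    tr (generator P X) = 0 := by
  let m := minpoly ℂ X.toLinearMap
  have hsf : Squarefree m :=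
    Module.End.IsSemisimple.minpoly_squarefree (Module.End.isFinitelySemisimple_iff_isSemisimple.1
      (ContinuousLinearMap.isSelfAdjoint_iff_isSymmetric.1 hXs).isFinitelySemisimple)
  obtain ⟨s, r, hrs⟩ := (PerfectField.separable_iff_squarefree.2 hsf : m.Separable)
  have hm : Polynomial.aeval X m = 0 := by
    refine ContinuousLinearMap.coe_injective ?_
    have h := Polynomial.map_aeval_eq_aeval_map (φ := RingHom.id ℂ)
      (ψ := (ContinuousLinearMap.toLinearMapRingHom : Op H →+* H →ₗ[ℂ] H)) (by ext; simp) m X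
    rw [Polynomial.map_id] at h
    exact h.trans (minpoly.aeval ℂ _)
  have hQ := hP.tr_generator_aeval hX (Polynomial.X - r * m)
  have hd : Polynomial.derivative (Polynomial.X - r * m) =
      (s - Polynomial.derivative r) * m := by
    rw [Polynomial.derivative_sub, Polynomial.derivative_X, Polynomial.derivative_mul, ← hrs]
    ring
  rw [hd] at hQ
  simpa [hm, tr_zero] using hQ

end IsQMS

/-! ### Symmetric operators for an inner product -/

section spectral

variable {V : Type*} [AddCommGroup V] [Module ℂ V] [FiniteDimensional ℂ V]
  (c : InnerProductSpace.Core ℂ V) (T : V →ₗ[ℂ] V)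
  (hT : ∀ x y, c.inner (T x) y = c.inner x (T y))
include hT

/-- Diagonalization of a symmetric operator `T`: a family of scalars `l i` and vectors `b i` with
`T (b i) = l i • b i` and the resulting formulas for the quadratic forms. -/
lemma exists_diagonalization : ∃ (n : ℕ) (l : Fin n → ℝ) (b : Fin n → V),
    (∀ i, Module.End.HasEigenvector T (l i : ℂ) (b i)) ∧
    (∀ μ : ℝ, Module.End.HasEigenvalue T (μ : ℂ) → ∃ i, l i = μ) ∧
    (∀ x, (∀ i, c.inner (b i) x = 0) → x = 0) ∧
    (∀ x, (c.inner x x).re = ∑ i, ‖c.inner (b i) x‖ ^ 2) ∧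
    (∀ x, (c.inner x (T x)).re = ∑ i, l i * ‖c.inner (b i) x‖ ^ 2) := by
  let _ : NormedAddCommGroup V := c.toNormedAddCommGroup
  let _ : InnerProductSpace ℂ V := InnerProductSpace.ofCore c.toCore
  have hs : T.IsSymmetric := hT
  let B := hs.eigenvectorBasis rfl
  let l := hs.eigenvalues rfl
  have hB : ∀ i, T (B i) = (l i : ℂ) • B i := hs.apply_eigenvectorBasis rfl
  have hsum : ∀ x y : V, inner ℂ x y = ∑ i, inner ℂ x (B i) * inner ℂ (B i) y := fun x y =>
    (B.sum_inner_mul_inner x y).symm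
  have hcoef : ∀ i x, inner ℂ (B i) (T x) = (l i : ℂ) * inner ℂ (B i) x := fun i x => by
    rw [← hs, hB, inner_smul_left, Complex.conj_ofReal]
  have hnorm : ∀ i x, inner ℂ x (B i) * inner ℂ (B i) x = ((‖inner ℂ (B i) x‖ ^ 2 : ℝ) : ℂ) :=
    fun i x => by
      rw [← inner_conj_symm, Complex.conj_mul']
      push_cast
      rfl
  refine ⟨_, l, B, hs.hasEigenvector_eigenvectorBasis rfl, fun μ hμ => ?_, fun x hx => ?_,
    fun x => ?_, fun x => ?_⟩
  · obtain ⟨i, hi⟩ := hs.exists_eigenvalues_eq rfl hμ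
    exact ⟨i, Complex.ofReal_injective hi⟩
  · refine inner_self_eq_zero (𝕜 := ℂ).1 ?_
    rw [hsum]
    exact Finset.sum_eq_zero fun i _ => by
      rw [show inner ℂ (B i) x = 0 from hx i, mul_zero]
  · change (inner ℂ x x).re = ∑ i, ‖inner ℂ (B i) x‖ ^ 2
    rw [hsum, Complex.re_sum]
    exact Finset.sum_congr rfl fun i _ => by rw [hnorm, Complex.ofReal_re]
  · change (inner ℂ x (T x)).re = ∑ i, l i * ‖inner ℂ (B i) x‖ ^ 2
    rw [hsum, Complex.re_sum]
    refine Finset.sum_congr rfl fun i _ => ?_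
    rw [hcoef, mul_left_comm, hnorm, Complex.re_ofReal_mul, Complex.ofReal_re]

lemma re_inner_apply_nonpos (hl : ∀ μ : ℝ, Module.End.HasEigenvalue T (μ : ℂ) → μ ≤ 0) (x : V) :
    (c.inner x (T x)).re ≤ 0 := by
  obtain ⟨n, l, b, hb, -, -, -, hq⟩ := exists_diagonalization c T hT
  rw [hq]
  exact Finset.sum_nonpos fun i _ => mul_nonpos_of_nonpos_of_nonneg
    (hl _ (Module.End.hasEigenvalue_of_hasEigenvector (hb i))) (by positivity)

variable (hneg : ∀ x, (c.inner x (T x)).re ≤ 0)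
include hneg

omit hT [FiniteDimensional ℂ V] in
lemma eigenvalue_nonpos {μ : ℝ} {x : V} (hx : Module.End.HasEigenvector T (μ : ℂ) x) : μ ≤ 0 := by
  have h := hneg x
  have hpos : 0 < (c.inner x x).re := by
    refine lt_of_le_of_ne (c.re_inner_nonneg x) fun h0 => hx.2 (c.definite x (Complex.ext h0.symm ?_))
    have := congrArg Complex.im (c.conj_inner_symm x x)
    simp only [Complex.conj_im] at this
    simp only [Complex.zero_im]
    linarith
  have hr : c.inner x ((μ : ℂ) • x) = μ * c.inner x x := by
    rw [← c.conj_inner_symm, c.smul_left, map_mul, c.conj_inner_symm, Complex.conj_conj]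
  rw [hx.apply_eq_smul, hr, Complex.re_ofReal_mul] at h
  exact nonpos_of_mul_nonpos_left h hpos

/-- An isotropic vector of a negative semidefinite symmetric operator lies in its kernel. -/
lemma apply_eq_zero_of_re_inner_eq_zero {x : V} (hx : (c.inner x (T x)).re = 0) : T x = 0 := by
  obtain ⟨n, l, b, hb, -, hext, -, hq⟩ := exists_diagonalization c T hT
  have hl : ∀ i, l i ≤ 0 := fun i => eigenvalue_nonpos c T hneg (hb i)
  rw [hq, Finset.sum_eq_zero_iff_of_nonpos fun i _ =>
    mul_nonpos_of_nonpos_of_nonneg (hl i) (by positivity)] at hx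
  refine hext _ fun i => ?_
  rw [← hT, (hb i).apply_eq_smul, c.smul_left]
  rcases mul_eq_zero.1 (hx i (Finset.mem_univ i)) with h | h
  · simp [h]
  · simp only [ne_eq, OfNat.ofNat_ne_zero, not_false_eq_true, pow_eq_zero_iff, norm_eq_zero] at h
    rw [h, mul_zero]

/-- A nonzero negative semidefinite symmetric operator has a greatest nonzero eigenvalue `ν`, and
its quadratic form is bounded by `ν ‖·‖²` on the orthogonal complement of its kernel. -/
lemma exists_isGreatest_eigenvalue (h0 : T ≠ 0) : ∃ ν : ℝ, ν < 0 ∧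
    IsGreatest {μ : ℝ | μ ≠ 0 ∧ Module.End.HasEigenvalue T (μ : ℂ)} ν ∧
    ∀ y, (∀ x, T x = 0 → c.inner x y = 0) → (c.inner y (T y)).re ≤ ν * (c.inner y y).re := by
  obtain ⟨n, l, b, hb, hall, hext, hn, hq⟩ := exists_diagonalization c T hT
  have hl : ∀ i, l i ≤ 0 := fun i => eigenvalue_nonpos c T hneg (hb i)
  have hev : ∀ i, Module.End.HasEigenvalue T (l i : ℂ) := fun i =>
    Module.End.hasEigenvalue_of_hasEigenvector (hb i)
  obtain ⟨j, hj⟩ : ∃ j, l j ≠ 0 := by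
    by_contra! h
    refine h0 (LinearMap.ext fun x => ?_)
    refine apply_eq_zero_of_re_inner_eq_zero c T hT hneg ?_
    rw [hq]
    exact Finset.sum_eq_zero fun i _ => by rw [h i, zero_mul]
  obtain ⟨k, hk, hmax⟩ := (Finset.univ.filter fun i => l i ≠ 0).exists_max_image l ⟨j, by simp [hj]⟩
  simp only [Finset.mem_filter, Finset.mem_univ, true_and] at hk hmax
  refine ⟨l k, lt_of_le_of_ne (hl k) hk, ⟨⟨hk, hev k⟩, fun μ hμ => ?_⟩, fun y hy => ?_⟩
  · obtain ⟨i, rfl⟩ := hall μ hμ.2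
    exact hmax i hμ.1
  · rw [hq, hn, Finset.mul_sum]
    refine Finset.sum_le_sum fun i _ => ?_
    by_cases hi : l i = 0
    · rw [hy (b i) (by rw [(hb i).apply_eq_smul, hi]; simp)]
      simp
    · exact mul_le_mul_of_nonneg_right (hmax i hi) (by positivity)

end spectral

/-! ### The Dirichlet form and the decay of the variance -/

lemma _root_.HasDerivWithinAt.tr {f : ℝ → Op H} {f' : Op H} {s : Set ℝ} {t : ℝ}
    (hf : HasDerivWithinAt f f' s t) : HasDerivWithinAt (fun u => tr (f u)) (tr f') s t := by
  let l : Op H →L[ℂ] ℂ := LinearMap.toContinuousLinearMap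
    ((LinearMap.trace ℂ H) ∘ₗ (ContinuousLinearMap.coeLM ℂ : Op H →ₗ[ℂ] H →ₗ[ℂ] H))
  exact (l.restrictScalars ℝ).hasFDerivAt.comp_hasDerivWithinAt t hf

lemma _root_.HasDerivWithinAt.kms {σ : Op H} {f g : ℝ → Op H} {f' g' : Op H} {s : Set ℝ} {t : ℝ}
    (hf : HasDerivWithinAt f f' s t) (hg : HasDerivWithinAt g g' s t) :
    HasDerivWithinAt (fun u => kms σ (f u) (g u)) (kms σ f' (g t) + kms σ (f t) g') s t := by
  have h := (((hf.star.const_mul (CFC.sqrt σ)).mul_const (CFC.sqrt σ)).mul hg).tr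
  rw [tr_add] at h
  exact h

namespace IsQMS

variable {P : ℝ → SuperOp H} (hP : IsQMS P) {σ : Op H} (hσ : IsFaithfulState σ)
  (hinv : IsInvariant P σ)
include hP

/-- `P t` acts on an eigenvector of the generator by an exponential. -/
lemma map_of_generator_eq {X : Op H} {μ : ℝ} (hX : generator P X = (μ : ℂ) • X) {t : ℝ}
    (ht : 0 ≤ t) : P t X = Real.exp (μ * t) • X := by
  let g : ℝ → Op H := fun s => Real.exp (-(μ * s)) • P s X
  have hd : ∀ s, 0 ≤ s → HasDerivWithinAt g 0 (Ici 0) s := fun s hs => by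
    have h1 : HasDerivWithinAt (fun s => Real.exp (-(μ * s))) (Real.exp (-(μ * s)) * -μ)
        (Ici 0) s := by
      have := (((hasDerivAt_id s).const_mul μ).neg.exp).hasDerivWithinAt (s := Ici 0)
      simpa using this
    refine (h1.smul (hP.hasDerivWithinAt_apply X hs)).congr_deriv ?_
    rw [hX, map_smul, Complex.coe_smul, smul_smul, ← add_smul]
    simp
  have h := constant_of_has_deriv_right_zero (a := 0) (b := t) (f := g)
    (fun s hs => (hd s hs.1).continuousWithinAt.mono Icc_subset_Ici_self)
    (fun s hs => (hd s hs.1).mono (Ici_subset_Ici.2 hs.1)) t ⟨ht, le_rfl⟩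
  simp only [g, hP.map_zero, mul_zero, neg_zero, Real.exp_zero, one_smul] at h
  calc P t X = Real.exp (μ * t) • Real.exp (-(μ * t)) • P t X := by
        rw [smul_smul, ← Real.exp_add]
        simp
    _ = Real.exp (μ * t) • X := by rw [h, ContinuousLinearMap.id_apply]

include hσ hinv

lemma condExp_generator (X : Op H) :
    condExp P σ (generator P X) = generator P (condExp P σ X) := by
  have h1 := ((condExp P σ).restrictScalars ℝ).hasFDerivAt.comp_hasDerivWithinAt 0
    (hP.hasDerivWithinAt_zero X)
  have h2 := (hP.hasDerivWithinAt_zero (condExp P σ X)).congr_of_mem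
    (f₁ := fun t => condExp P σ (P t X)) (fun t ht => hP.condExp_map hσ hinv X ht) self_mem_Ici
  exact (uniqueDiffOn_Ici 0 0 self_mem_Ici).eq_deriv _ h1 h2

/-- The Dirichlet form vanishes on `N(P)`: there `2 Re Tr[X^* L(X)] = Tr[L(X^* X)] = 0`. -/
lemma re_kms_generator_of_mem {X : Op H} (hX : X ∈ dfAlgebra P) :
    (kms (sigmaTr P σ) X (generator P X)).re = 0 := by
  have hXs : star X ∈ dfAlgebra P := hP.dfSubalgebra.star_mem' hX
  have h := hP.tr_generator_of_isSelfAdjoint (hP.dfSubalgebra.mul_mem hXs hX)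
    (IsSelfAdjoint.star_mul_self X)
  have h2 : generator P (star X) * X = star (star X * generator P X) := by
    rw [hP.generator_star, star_mul, star_star]
  rw [hP.generator_mul hXs, tr_add, h2, tr_star] at h
  rw [hP.kms_of_mem_left hσ hinv hX, hP.condExp_generator hσ hinv, hP.condExp_of_mem hσ hinv hX]
  have h3 := congrArg Complex.re h
  simp only [Complex.add_re, Complex.zero_re, Complex.star_def, Complex.conj_re] at h3
  have h4 : (tr (star X * generator P X)).re = 0 := by linarith
  rw [← Complex.ofReal_natCast, ← Complex.ofReal_inv, Complex.re_ofReal_mul, h4, mul_zero]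

/-- With `Y = X - E_N(X)` one has `P t Y = P t X - E_N(P t X)`, and the inequality makes
`e^{2λt} ‖P t Y‖²` nonincreasing. -/
lemma dfVar_map_le {lam : ℝ} (hlam : PoincareIneq P σ lam) {X : Op H} (hX : IsSelfAdjoint X)
    {t : ℝ} (ht : 0 ≤ t) : dfVar P σ (P t X) ≤ Real.exp (-2 * lam * t) * dfVar P σ X := by
  set Y := X - condExp P σ X with hY
  have hYs : IsSelfAdjoint Y := hX.sub (by
    rw [IsSelfAdjoint, ← hP.condExp_star hσ hinv, hX.star_eq])
  have hEY : condExp P σ Y = 0 := by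
    rw [hY, map_sub, (hP.isDFCondExp_condExp hσ hinv).idem, sub_self]
  have hvar : ∀ t, 0 ≤ t → dfVar P σ (P t X) = normSq (sigmaTr P σ) (P t Y) := fun t ht => by
    rw [dfVar, hP.condExp_map hσ hinv X ht, ← map_sub]
  have hvarY : ∀ t, 0 ≤ t → dfVar P σ (P t Y) = normSq (sigmaTr P σ) (P t Y) := fun t ht => by
    rw [dfVar, hP.condExp_map_eq_zero hσ hinv hEY ht, sub_zero]
  let f : ℝ → ℝ := fun t => Real.exp (2 * lam * t) * normSq (sigmaTr P σ) (P t Y)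
  have hd : ∀ t, 0 ≤ t → HasDerivWithinAt f (Real.exp (2 * lam * t) *
      (2 * lam * normSq (sigmaTr P σ) (P t Y) -
        2 * dirichlet (sigmaTr P σ) (generator P) (P t Y))) (Ici 0) t := fun t ht => by
    have h1 := hP.hasDerivWithinAt_apply' Y ht
    have h2 := Complex.reCLM.hasFDerivAt.comp_hasDerivWithinAt t (h1.kms (σ := sigmaTr P σ) h1)
    have h3 : HasDerivWithinAt (fun t => Real.exp (2 * lam * t))
        (Real.exp (2 * lam * t) * (2 * lam)) (Ici 0) t := by
      have := (((hasDerivAt_id t).const_mul (2 * lam)).exp).hasDerivWithinAt (s := Ici 0)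
      simpa using this
    refine (h3.mul h2).congr_deriv ?_
    rw [Complex.reCLM_apply, Complex.add_re,
      ← kms_conj_symm (sigmaTr P σ) (generator P (P t Y)) (P t Y), dirichlet]
    simp only [Complex.star_def, Complex.conj_re]
    change _ * normSq (sigmaTr P σ) (P t Y) + _ = _
    ring
  have hanti : AntitoneOn f (Ici 0) := by
    refine antitoneOn_of_hasDerivWithinAt_nonpos (convex_Ici 0)
      (fun t ht => (hd t ht).continuousWithinAt)
      (fun t ht => (hd t (interior_subset ht)).mono interior_subset) fun t ht => ?_
    have ht0 : 0 ≤ t := interior_subset ht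
    have hs : IsSelfAdjoint (P t Y) := by
      rw [IsSelfAdjoint, ← (hP.cp t ht0).map_star, hYs.star_eq]
    have h := hlam.2 (P t Y) hs
    rw [hvarY t ht0] at h
    exact mul_nonpos_of_nonneg_of_nonpos (Real.exp_pos _).le (by linarith)
  have h := hanti self_mem_Ici ht ht
  have h0 : f 0 = dfVar P σ X := by simp [f, hP.map_zero, dfVar, hY]
  rw [h0] at h
  rw [hvar t ht, show -2 * lam * t = -(2 * lam * t) by ring, Real.exp_neg,
    ← div_eq_inv_mul, le_div_iff₀' (Real.exp_pos _)]
  exact h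

end IsQMS

/-! ### The Poincaré constant and the spectral gap -/

/-- Every operator is a complex combination of two selfadjoint ones. -/
lemma eq_combination (X : Op H) :
    X = (2⁻¹ : ℂ) • ((X + star X) - Complex.I • (Complex.I • (X - star X))) := by
  rw [smul_smul, Complex.I_mul_I, neg_one_smul, sub_neg_eq_add, add_add_sub_cancel, ← two_smul ℂ,
    smul_smul]
  norm_num

lemma isSelfAdjoint_add_star (X : Op H) : IsSelfAdjoint (X + star X) :=
  IsSelfAdjoint.add_star_self X

lemma isSelfAdjoint_I_smul_sub_star (X : Op H) : IsSelfAdjoint (Complex.I • (X - star X)) := by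
  simp [IsSelfAdjoint, ← smul_neg]

/-- A quadratic form `Re⟨X, T X⟩`, with `T` commuting with `star`, is determined by its values on
selfadjoint elements. -/
lemma four_mul_re_kms (σ : Op H) {T : SuperOp H} (hT : ∀ X, T (star X) = star (T X)) (X : Op H) :
    4 * (kms σ X (T X)).re = (kms σ (X + star X) (T (X + star X))).re +
      (kms σ (Complex.I • (X - star X)) (T (Complex.I • (X - star X)))).re := by
  have h := kms_star_star σ X (T X)
  simp only [map_smul, map_add, map_sub, hT, kms_smul_left, kms_smul_right, kms_add_left,
    kms_add_right, kms_sub_left, kms_sub_right, h]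
  simp only [Complex.star_def, Complex.conj_I, Complex.add_re, Complex.sub_re, Complex.mul_re,
    Complex.neg_re, Complex.neg_im, Complex.I_re, Complex.I_im, Complex.mul_im, Complex.sub_im,
    Complex.conj_re, Complex.conj_im]
  ring

lemma kmsAdjoint_star {σ : Op H} (hσ : IsStrictlyPositive σ) {Φ : SuperOp H}
    (hΦ : ∀ X, Φ (star X) = star (Φ X)) (X : Op H) :
    kmsAdjoint σ Φ (star X) = star (kmsAdjoint σ Φ X) := by
  refine kms_ext hσ fun Z => ?_
  rw [kms_kmsAdjoint σ hσ, ← star_star Z, hΦ, kms_star_star, kms_star_star, kms_kmsAdjoint σ hσ]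

lemma kms_kmsAdjoint_right {σ : Op H} (hσ : IsStrictlyPositive σ) (Φ : SuperOp H) (X Y : Op H) :
    kms σ X (kmsAdjoint σ Φ Y) = kms σ (Φ X) Y := by
  rw [← kms_conj_symm, kms_kmsAdjoint σ hσ, kms_conj_symm]

namespace IsQMS

variable {P : ℝ → SuperOp H} (hP : IsQMS P) {σ : Op H} (hσ : IsFaithfulState σ)
  (hinv : IsInvariant P σ)
include hP hσ hinv

lemma kms_symGenerator (X Y : Op H) : kms (sigmaTr P σ) (symGenerator P σ X) Y =
    kms (sigmaTr P σ) X (symGenerator P σ Y) := by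
  have hs := hP.isStrictlyPositive_sigmaTr hσ hinv
  simp only [symGenerator, smul_apply, add_apply,
    kms_smul_left, kms_smul_right, kms_add_left, kms_add_right, kms_kmsAdjoint _ hs,
    kms_kmsAdjoint_right hs]
  rw [add_comm]
  simp

lemma symGenerator_star (X : Op H) :
    symGenerator P σ (star X) = star (symGenerator P σ X) := by
  simp [symGenerator, hP.generator_star,
    kmsAdjoint_star (hP.isStrictlyPositive_sigmaTr hσ hinv) hP.generator_star]

lemma re_kms_symGenerator (X : Op H) : (kms (sigmaTr P σ) X (symGenerator P σ X)).re =
    -dirichlet (sigmaTr P σ) (generator P) X := by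
  have hs := hP.isStrictlyPositive_sigmaTr hσ hinv
  have h : kms (sigmaTr P σ) X (symGenerator P σ X) = ((2⁻¹ : ℝ) : ℂ) *
      (kms (sigmaTr P σ) X (generator P X) + star (kms (sigmaTr P σ) X (generator P X))) := by
    simp [symGenerator, kms_smul_right, kms_add_right, kms_kmsAdjoint_right hs,
      ← kms_conj_symm (sigmaTr P σ) (generator P X) X]
    ring
  rw [h, Complex.re_ofReal_mul, dirichlet]
  simp only [Complex.add_re, Complex.star_def, Complex.conj_re]
  ring

/-- If `(L + L̂) / 2` is negative semidefinite with kernel contained in `N(P)`, then the optimal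
Poincaré constant is its spectral gap. -/
theorem exists_isPoincareConst (hN : dfAlgebra P ≠ univ)
    (hneg : ∀ X, (kms (sigmaTr P σ) X (symGenerator P σ X)).re ≤ 0)
    (hker : ∀ X, symGenerator P σ X = 0 → X ∈ dfAlgebra P) :
    ∃ γ : ℝ, IsPoincareConst P σ γ ∧ IsSpectralGap (symGenerator P σ) γ := by
  have hs := hP.isStrictlyPositive_sigmaTr hσ hinv
  set τ := sigmaTr P σ with hτ
  set K := symGenerator P σ with hK
  have hsymm := hP.kms_symGenerator hσ hinv
  have hdir := hP.re_kms_symGenerator hσ hinv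
  rw [← hτ, ← hK] at hsymm hdir
  have hkerN : ∀ X ∈ dfAlgebra P, K X = 0 := fun X hX =>
    apply_eq_zero_of_re_inner_eq_zero (kmsCore τ hs) K.toLinearMap hsymm hneg
      (by
        change (kms τ X (K X)).re = 0
        rw [hdir, dirichlet, hP.re_kms_generator_of_mem hσ hinv hX, neg_zero, neg_zero])
  obtain ⟨ν, hν, hgr, hgap⟩ := exists_isGreatest_eigenvalue (kmsCore τ hs) K.toLinearMap hsymm hneg
    (fun h0 => hN (eq_univ_of_forall fun X => hker X (LinearMap.congr_fun h0 X)))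
  refine ⟨-ν, ⟨⟨neg_pos.2 hν, fun X hX => ?_⟩, fun lam hlam => ?_⟩, ν, hgr,
    (abs_of_neg hν).symm⟩
  · set Y := X - condExp P σ X with hY
    have hmem := hP.condExp_mem hσ hinv X
    have hKY : K Y = K X := by rw [hY, map_sub, hkerN _ hmem, sub_zero]
    have hq : kms τ X (K X) = kms τ Y (K Y) := by
      rw [hKY, hY, kms_sub_left, ← hsymm (condExp P σ X), hkerN _ hmem]
      simp [kms, tr_zero]
    have h := hgap Y fun Z hZ => hP.kms_sub_condExp hσ hinv (hker Z hZ) X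
    change (kms τ Y (K Y)).re ≤ ν * normSq τ Y at h
    rw [← hq, hdir] at h
    change -ν * normSq τ Y ≤ _
    linarith
  · -- A selfadjoint eigenvector of `ν` saturates the inequality.
    obtain ⟨X, hX⟩ := hgr.1.2.exists_hasEigenvector
    have hKX : K X = (ν : ℂ) • X := hX.apply_eq_smul
    have hKXs : K (star X) = (ν : ℂ) • star X := by
      rw [hP.symGenerator_star hσ hinv, ← hK, hKX]
      simp
    obtain ⟨W, hWs, hW0, hKW⟩ : ∃ W, IsSelfAdjoint W ∧ W ≠ 0 ∧ K W = (ν : ℂ) • W := by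
      by_cases hA : X + star X = 0
      · refine ⟨Complex.I • (X - star X), isSelfAdjoint_I_smul_sub_star X, fun hB => hX.2 ?_, ?_⟩
        · rw [eq_combination X, hA, hB]
          simp
        · rw [map_smul, map_sub, hKX, hKXs, ← smul_sub, smul_comm]
      · exact ⟨_, isSelfAdjoint_add_star X, hA, by rw [_root_.map_add, hKX, hKXs, smul_add]⟩
    have horth : ∀ Z ∈ dfAlgebra P, kms τ Z W = 0 := fun Z hZ => by
      have h := hsymm Z W
      rw [hkerN Z hZ, hKW, kms_smul_right] at h
      have h0 : kms τ 0 W = 0 := by simp [kms, tr_zero]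
      rw [h0] at h
      exact (mul_eq_zero.1 h.symm).resolve_left (by exact_mod_cast hν.ne)
    have hmem := hP.condExp_mem hσ hinv W
    have hEW : condExp P σ W = 0 := eq_zero_of_kms_self hs (by
      have h := hP.kms_sub_condExp hσ hinv hmem W
      rw [kms_sub_right, ← hτ, horth _ hmem, zero_sub, neg_eq_zero] at h
      exact h)
    have hpos : 0 < normSq τ W :=
      lt_of_le_of_ne (normSq_nonneg τ W) fun h => hW0 (eq_zero_of_normSq hs h.symm)
    have h := hlam.2 W hWs
    have hdW := hdir W
    rw [hKW, kms_smul_right, Complex.re_ofReal_mul] at hdW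
    change ν * normSq τ W = _ at hdW
    rw [dfVar, hEW, sub_zero, ← hτ] at h
    exact le_of_mul_le_mul_right (by linarith) hpos

lemma mem_of_dfVar_le_zero {X : Op H} (h : dfVar P σ X ≤ 0) : X ∈ dfAlgebra P := by
  have h0 := eq_zero_of_normSq (hP.isStrictlyPositive_sigmaTr hσ hinv)
    (le_antisymm h (normSq_nonneg _ _))
  rw [sub_eq_zero.1 h0]
  exact hP.condExp_mem hσ hinv X

/-- A Poincaré inequality makes `(L + L̂) / 2` negative semidefinite with kernel in `N(P)`: first on
selfadjoint elements, then on all of `B(H)`, since the operator commutes with `star`. -/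
theorem exists_isPoincareConst_of_poincareIneq (hN : dfAlgebra P ≠ univ) {lam : ℝ}
    (hlam : PoincareIneq P σ lam) :
    ∃ γ : ℝ, IsPoincareConst P σ γ ∧ IsSpectralGap (symGenerator P σ) γ := by
  have hstar := hP.symGenerator_star hσ hinv
  have hsa : ∀ X, IsSelfAdjoint X → lam * dfVar P σ X ≤
      -(kms (sigmaTr P σ) X (symGenerator P σ X)).re := fun X hX => by
    rw [hP.re_kms_symGenerator hσ hinv, neg_neg]
    exact hlam.2 X hX
  have hnn : ∀ X, 0 ≤ lam * dfVar P σ X := fun X =>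
    mul_nonneg hlam.1.le (normSq_nonneg _ _)
  refine hP.exists_isPoincareConst hσ hinv hN (fun X => ?_) fun X hX => ?_
  · have h := four_mul_re_kms (sigmaTr P σ) hstar X
    have h1 := (hnn _).trans (hsa _ (isSelfAdjoint_add_star X))
    have h2 := (hnn _).trans (hsa _ (isSelfAdjoint_I_smul_sub_star X))
    linarith
  · have hsaN : ∀ Y, IsSelfAdjoint Y → symGenerator P σ Y = 0 → Y ∈ dfAlgebra P :=
      fun Y hY h0 => by
        have h := hsa Y hY
        rw [h0] at h
        have hz : kms (sigmaTr P σ) Y 0 = 0 := by simp [kms, tr_zero]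
        rw [hz, Complex.zero_re, neg_zero] at h
        exact hP.mem_of_dfVar_le_zero hσ hinv (nonpos_of_mul_nonpos_right h hlam.1)
    have hXs : symGenerator P σ (star X) = 0 := by rw [hstar, hX, star_zero]
    rw [eq_combination X]
    refine hP.dfSubalgebra.smul_mem (hP.dfSubalgebra.sub_mem (hsaN _ (isSelfAdjoint_add_star X) ?_)
      (hP.dfSubalgebra.smul_mem (hsaN _ (isSelfAdjoint_I_smul_sub_star X) ?_) _)) _
    · rw [_root_.map_add, hX, hXs, add_zero]
    · rw [map_smul, map_sub, hX, hXs, sub_zero, smul_zero]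

lemma kms_generator_of_isReversible (hrev : IsReversible P σ) (X Y : Op H) :
    kms (sigmaTr P σ) (generator P X) Y = kms (sigmaTr P σ) X (generator P Y) := by
  have h1 := (hP.hasDerivWithinAt_zero X).kms (σ := sigmaTr P σ)
    (hasDerivWithinAt_const (0 : ℝ) (Ici 0) Y)
  have h2 := ((hasDerivWithinAt_const (0 : ℝ) (Ici 0) X).kms (σ := sigmaTr P σ)
    (hP.hasDerivWithinAt_zero Y)).congr_of_mem (f₁ := fun t => kms (sigmaTr P σ) (P t X) Y)
    (fun t ht => hrev t ht X Y) self_mem_Ici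
  have h3 := (uniqueDiffOn_Ici 0 0 self_mem_Ici).eq_deriv _ h1 h2
  simpa [kms, tr_zero] using h3

lemma symGenerator_of_isReversible (hrev : IsReversible P σ) :
    symGenerator P σ = generator P := by
  have hs := hP.isStrictlyPositive_sigmaTr hσ hinv
  have h : kmsAdjoint (sigmaTr P σ) (generator P) = generator P :=
    ContinuousLinearMap.ext fun X => kms_ext hs fun Z => by
      rw [kms_kmsAdjoint _ hs, hP.kms_generator_of_isReversible hσ hinv hrev]
  rw [symGenerator, h, ← two_smul ℂ, smul_smul]
  norm_num

/-- Fixed points of the semigroup lie in `N(P)`. -/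
lemma mem_dfAlgebra_of_generator_eq_zero {X : Op H} (hX : generator P X = 0) :
    X ∈ dfAlgebra P := by
  have hfix : ∀ Y, generator P Y = 0 → ∀ t, 0 ≤ t → P t Y = Y := fun Y hY t ht => by
    simpa using hP.map_of_generator_eq (μ := 0) (by simpa using hY) ht
  refine hP.mem_dfAlgebra_of_gnsSq_le hσ hinv (fun t ht => ?_) fun t ht => ?_
  · rw [hfix X hX t ht]
  · rw [hfix _ (by rw [hP.generator_star, hX, star_zero]) t ht]

omit hσ hinv in
/-- Since `P t` is a contraction, `exp (μ t)` stays bounded as `t` grows. -/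
lemma eigenvalue_generator_nonpos {μ : ℝ}
    (hμ : Module.End.HasEigenvalue (generator P).toLinearMap (μ : ℂ)) : μ ≤ 0 := by
  obtain ⟨X, hX⟩ := hμ.exists_hasEigenvector
  have h := hP.map_of_generator_eq hX.apply_eq_smul zero_le_one
  have h1 := ((P 1).le_opNorm X).trans (mul_le_of_le_one_left (norm_nonneg _)
    ((hP.cp 1 zero_le_one).norm_le_one (hP.unital 1 zero_le_one)))
  rw [h, norm_smul, Real.norm_eq_abs, Real.abs_exp, mul_one] at h1
  have h2 := le_of_mul_le_mul_right (h1.trans (one_mul _).ge) (norm_pos_iff.2 hX.2)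
  simpa using h2

end IsQMS

end QMS

theorem theorem3p1 {H : Type*} [NormedAddCommGroup H] [InnerProductSpace ℂ H]
    [FiniteDimensional ℂ H] [CompleteSpace H] (P : ℝ → SuperOp H) (hP : QMS.IsQMS P)
    (σ : Op H) (hσ : QMS.IsFaithfulState σ) (hinv : QMS.IsInvariant P σ) :
    (∀ lam : ℝ, QMS.PoincareIneq P σ lam →
      ∀ X : Op H, IsSelfAdjoint X → ∀ t : ℝ, 0 ≤ t →
        QMS.dfVar P σ (P t X) ≤ Real.exp (-2 * lam * t) * QMS.dfVar P σ X) ∧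
    (QMS.dfAlgebra P ≠ Set.univ → (∃ lam : ℝ, QMS.PoincareIneq P σ lam) →
      ∃ γ : ℝ, QMS.IsPoincareConst P σ γ ∧ QMS.IsSpectralGap (QMS.symGenerator P σ) γ) ∧
    (QMS.dfAlgebra P ≠ Set.univ → QMS.IsReversible P σ →
      ∃ γ : ℝ, QMS.IsPoincareConst P σ γ ∧ QMS.IsSpectralGap (QMS.symGenerator P σ) γ ∧
        QMS.IsSpectralGap (QMS.generator P) γ) := by
  refine ⟨fun lam hlam X hX t ht => hP.dfVar_map_le hσ hinv hlam hX ht,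
    fun hN ⟨lam, hlam⟩ => hP.exists_isPoincareConst_of_poincareIneq hσ hinv hN hlam,
    fun hN hrev => ?_⟩
  have hKL := hP.symGenerator_of_isReversible hσ hinv hrev
  obtain ⟨γ, h1, h2⟩ := hP.exists_isPoincareConst hσ hinv hN
    (fun X => by
      rw [hKL]
      exact QMS.re_inner_apply_nonpos (QMS.kmsCore _ (hP.isStrictlyPositive_sigmaTr hσ hinv))
        (QMS.generator P).toLinearMap (hP.kms_generator_of_isReversible hσ hinv hrev)
        (fun μ => hP.eigenvalue_generator_nonpos) X)
    (fun X hX => hP.mem_dfAlgebra_of_generator_eq_zero hσ hinv (by rwa [hKL] at hX))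
  exact ⟨γ, h1, h2, by rwa [hKL] at h2⟩
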